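/- Let $n\ge 0$ and $N>n$ be integers, $T>0$, and let $L_t=(L^{(1)}_t,\dots,L^{(n)}_t)$, $0\le t\le T$, be $n$ independent rate $1$ Poisson processes, the $i$-th one started at $L^{(i)}_0=1-i$, conditioned on the event $E$ that no two of them meet during $[0,T]$ and that $L_T=(N,N-1,\dots,N-n+1)$. Fix $k\ge1$ times $0<t_1<\dots<t_k<T$, put $p_j=t_j/T$, and use the shifted positions $x^{(j)}_i=L^{(i)}_{t_j}+n-1$. The event $E$ has positive probability, and almost surely under the conditional law $N+n-1\ge x^{(j)}_1>\dots>x^{(j)}_n\ge 0$ for every $j$. There is a constant $C>0$, not depending on the configurations, such that for all such configurations $x^{(1)},\dots,x^{(k)}$ of integers $$\mathrm{Prob}[x^{(1)},\dots,x^{(k)}]=C\prod_{i<j}(x^{(1)}_i-x^{(1)}_j)\prod_{i=1}^n\frac{p_1^{x^{(1)}_i}}{x^{(1)}_i!}\;\prod_{l=1}^{k-1}\det\big(V_{p_{l+1}-p_l}(x^{(l)}_a,x^{(l+1)}_b)\big)_{a,b=1}^n\;\prod_{i<j}(x^{(k)}_i-x^{(k)}_j)\prod_{i=1}^n\frac{(1-p_k)^{N+n-1-x^{(k)}_i}}{(N+n-1-x^{(k)}_i)!},$$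 where $V_p(x,y)=p^{y-x}/(y-x)!$ if $y\ge x$ and $V_p(x,y)=0$ otherwise. Moreover this law is determinantal: for every $r\ge 0$ and all distinct space-time points $(i_1,y_1),\dots,(i_r,y_r)\in\{1,\dots,k\}\times\{0,\dots,N+n-1\}$, the probability that for each $a$ some bus has shifted position $y_a$ at time $t_{i_a}$ equals $\det\big(K_{t_{i_a},t_{i_b}}(y_a,y_b)\big)_{a,b=1}^r$, where $$K_{t_i,t_j}(x,y)=\frac1{(2\pi i)^2}\oint\oint\frac{(p_j-(1-p_j)t)^y(1+t)^{N+n-1-y}t^{-n}}{(p_i-(1-p_i)s)^{x+1}(1+s)^{N+n-x}s^{-n}}\,\frac{ds\,dt}{t-s}.$$ Here, for each pair $(i,j)$, $s$ and $t$ run along arbitrary simple positively oriented piecewise $C^1$ closed contours such that the $s$-contour goes around $\frac{p_i}{1-p_i}$ and does not contain $-1$ (which lies outside it), the $t$-contour goes around $0$, the $s$-contour contains the $t$-contour if $p_i\ge p_j$, and the $s$-contour lies inside the $t$-contour if $p_i<p_j$; such contours exist for every pair $(i,j)$. -/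

import Mathlib

open MeasureTheory ProbabilityTheory Set Topology
open scoped NNReal ENNReal Nat

noncomputable section

namespace BusModel

/-! ### Poisson processes and the conditioned bus system -/

/-- `X` is a Poisson (counting) process of rate `r` under `P`: it starts at `0`, its paths are
nondecreasing and right-continuous, its increments are independent, and the increment over
`[s, t]` has the Poisson law of mean `r * (t - s)`. The subtractions `X t ω - X s ω` and `t - s`
never truncate, since the paths are nondecreasing and `s ≤ t`. -/
structure IsPoissonProcess {Ω : Type*} [MeasurableSpace Ω] (X : ℝ≥0 → Ω → ℕ) (r : ℝ≥0)
    (P : Measure Ω) : Prop where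
  measurable : ∀ t, Measurable (X t)
  start_zero : ∀ ω, X 0 ω = 0
  monotone : ∀ ω, Monotone fun t => X t ω
  right_continuous : ∀ ω t, ContinuousWithinAt (fun s => X s ω) (Ici t) t
  indep_increments : HasIndepIncrements X P
  increment_law : ∀ s t, s ≤ t →
    HasLaw (fun ω => X t ω - X s ω) (poissonMeasure (r * (t - s))) P

/-- Location of bus `i` at time `t`. Buses are numbered from `0`, so that bus `i : Fin n` starts
at location `-i` (in numbering from `1`, the `i`-th bus starts at `1 - i`) and moves by the
counting process `X i`. -/
def busPos {Ω : Type*} {n : ℕ} (X : Fin n → ℝ≥0 → Ω → ℕ) (i : Fin n) (t : ℝ≥0) (ω : Ω) : ℤ :=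
  (X i t ω : ℤ) - (i : ℕ)

/-- The shifted location `L + n - 1`, which starts at `n - 1, …, 0`. -/
def shiftedPos {Ω : Type*} {n : ℕ} (X : Fin n → ℝ≥0 → Ω → ℕ) (i : Fin n) (t : ℝ≥0) (ω : Ω) : ℤ :=
  busPos X i t ω + n - 1

/-- The conditioning event: no two buses meet during `[0, T]`, and at time `T` the buses are at
`N, N - 1, …, N - n + 1`. -/
def busEvent {Ω : Type*} {n : ℕ} (X : Fin n → ℝ≥0 → Ω → ℕ) (N : ℕ) (T : ℝ≥0) : Set Ω :=
  {ω | (∀ t ≤ T, ∀ i j, i ≠ j → busPos X i t ω ≠ busPos X j t ω) ∧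
    ∀ i : Fin n, busPos X i T ω = (N : ℤ) - (i : ℕ)}

/-- The law of the bus system: the independent processes conditioned on `busEvent`. -/
def busLaw {Ω : Type*} [MeasurableSpace Ω] {n : ℕ} (P : Measure Ω) (X : Fin n → ℝ≥0 → Ω → ℕ)
    (N : ℕ) (T : ℝ≥0) : Measure Ω :=
  ProbabilityTheory.cond P (busEvent X N T)

/-! ### The explicit multi-time weight -/

/-- `V_p(x, y) = p ^ (y - x) / (y - x)!` for `y ≥ x`, and `0` otherwise. -/
def V (p : ℝ) (x y : ℕ) : ℝ := if x ≤ y then p ^ (y - x) / ((y - x)! : ℝ) else 0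

/-- The Vandermonde product `∏_{i < j} (x_i - x_j)`. -/
def vandermondeProd {n : ℕ} (x : Fin n → ℕ) : ℝ :=
  ∏ i, ∏ j ∈ Finset.Ioi i, ((x i : ℝ) - (x j : ℝ))

/-- The unnormalised joint weight of the configurations `x 0, …, x m` at `m + 1` times with
time fractions `p 0 < … < p m`. -/
def multiTimeWeight {n m : ℕ} (N : ℕ) (p : Fin (m + 1) → ℝ) (x : Fin (m + 1) → Fin n → ℕ) : ℝ :=
  vandermondeProd (x 0) * (∏ i, p 0 ^ x 0 i / ((x 0 i)! : ℝ)) *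
    (∏ l : Fin m,
      (Matrix.of fun a b : Fin n =>
        V (p l.succ - p l.castSucc) (x l.castSucc a) (x l.succ b)).det) *
    (vandermondeProd (x (Fin.last m)) *
      ∏ i, (1 - p (Fin.last m)) ^ (N + n - 1 - x (Fin.last m) i) /
        ((N + n - 1 - x (Fin.last m) i)! : ℝ))

/-! ### Contours and contour integrals -/

/-- A simple closed piecewise continuously differentiable curve in `ℂ`, parametrised by `[0, 1]`:
off a finite set of parameters it has a continuous derivative, and this derivative is bounded. -/
structure IsSimpleContour (γ : ℝ → ℂ) : Prop where
  continuousOn : ContinuousOn γ (Icc 0 1)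
  closed : γ 0 = γ 1
  simple : InjOn γ (Ico 0 1)
  piecewise : ∃ S : Finset ℝ,
    (∀ u ∈ Ioo (0 : ℝ) 1 \ S, DifferentiableAt ℝ γ u) ∧
    ContinuousOn (deriv γ) (Ioo (0 : ℝ) 1 \ S) ∧
    ∃ B : ℝ, ∀ u ∈ Ioo (0 : ℝ) 1 \ S, ‖deriv γ u‖ ≤ B

/-- `∮_γ f(z) dz`. -/
def contourIntegral (γ : ℝ → ℂ) (f : ℂ → ℂ) : ℂ := ∫ u in (0 : ℝ)..1, f (γ u) * deriv γ u

/-- The winding number of `γ` about `w` (for `w` not on `γ`). -/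
def windingNumber (γ : ℝ → ℂ) (w : ℂ) : ℂ :=
  (2 * (Real.pi : ℂ) * Complex.I)⁻¹ * contourIntegral γ fun z => 1 / (z - w)

/-- `γ` goes around `w` once in the positive direction: for a simple closed contour this says that
`γ` is positively oriented and `w` lies in its interior. -/
def GoesAround (γ : ℝ → ℂ) (w : ℂ) : Prop :=
  (∀ u ∈ Icc (0 : ℝ) 1, γ u ≠ w) ∧ windingNumber γ w = 1

/-- `w` lies outside of the closed contour `γ`. -/
def LiesOutside (γ : ℝ → ℂ) (w : ℂ) : Prop :=
  (∀ u ∈ Icc (0 : ℝ) 1, γ u ≠ w) ∧ windingNumber γ w = 0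

/-- The contour `γ` contains the contour `δ`: every point of `δ` is in the interior of `γ`, and
every point of `γ` is in the exterior of `δ`. For simple closed contours the second half is implied
by the first, by the Jordan curve theorem. -/
def ContourContains (γ δ : ℝ → ℂ) : Prop :=
  ∀ u ∈ Icc (0 : ℝ) 1, GoesAround γ (δ u) ∧ LiesOutside δ (γ u)

/-- Admissible pairs (`s`-contour `σ`, `t`-contour `τ`) for the time fractions `p, q`:
both are simple and positively oriented, `σ` goes around `p / (1 - p)` and does not contain `-1`,
`τ` goes around `0`, `σ` contains `τ` if `p ≥ q`, and `σ` lies inside `τ` if `p < q`. -/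
structure AdmissibleContours (p q : ℝ) (σ τ : ℝ → ℂ) : Prop where
  simple_s : IsSimpleContour σ
  simple_t : IsSimpleContour τ
  s_around : GoesAround σ ((p : ℂ) / (1 - (p : ℂ)))
  s_avoids : LiesOutside σ (-1)
  t_around : GoesAround τ 0
  s_contains_t : q ≤ p → ContourContains σ τ
  t_contains_s : p < q → ContourContains τ σ

/-- The double contour integral kernel, with `p` the time fraction attached to `x` (and to the
variable `s`) and `q` the one attached to `y` (and to the variable `t`); here `x, y < N + n`. -/
def busKernel (n N : ℕ) (p q : ℝ) (σ τ : ℝ → ℂ) (x y : ℕ) : ℂ :=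
  (1 / (2 * (Real.pi : ℂ) * Complex.I) ^ 2) *
    contourIntegral σ fun s => contourIntegral τ fun t =>
      (((q : ℂ) - (1 - (q : ℂ)) * t) ^ y * (1 + t) ^ (N + n - 1 - y) * t ^ (-(n : ℤ))) /
        (((p : ℂ) - (1 - (p : ℂ)) * s) ^ (x + 1) * (1 + s) ^ (N + n - x) * s ^ (-(n : ℤ))) *
        (1 / (t - s))

/-! ### Determinantal space-time processes -/

/-- The space-time correlation function at the points `z a = (time index, site)`: the probability
that for every `a` some bus occupies (in shifted coordinates) the site `(z a).2` at the time
`t (z a).1`. -/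
def correlation {Ω ι : Type*} [MeasurableSpace Ω] {n M r : ℕ} (Q : Measure Ω)
    (X : Fin n → ℝ≥0 → Ω → ℕ) (t : ι → ℝ≥0) (z : Fin r → ι × Fin M) : ℝ :=
  Q.real {ω | ∀ a, ∃ i, shiftedPos X i (t (z a).1) ω = (((z a).2 : ℕ) : ℤ)}

/-- The positions at the times `t j`, viewed as a random set of space-time points with sites in
`{0, …, M - 1}`, are determinantal with correlation kernel `K`: for each `r` and any `r` distinct
space-time points, the correlation function is the determinant of the matrix of values of `K`. -/
def IsDeterminantal {Ω ι : Type*} [MeasurableSpace Ω] {n : ℕ} (M : ℕ) (Q : Measure Ω)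
    (X : Fin n → ℝ≥0 → Ω → ℕ) (t : ι → ℝ≥0) (K : ι → ι → ℕ → ℕ → ℂ) : Prop :=
  ∀ (r : ℕ) (z : Fin r → ι × Fin M), Function.Injective z →
    ((correlation Q X t z : ℝ) : ℂ) =
      (Matrix.of fun a b : Fin r => K (z a).1 (z b).1 (z a).2 (z b).2).det

end BusModel

end

/-!
A rate one Poisson process jumps by `k` during a time `t` with probability `exp (-t) * t ^ k /
k!`. The Karlin–McGregor formula says that the probability that `n` independent ones go from `a`
to `y` during the time `t`, strictly ordered throughout, is `exp (-n t)` times the determinant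
`transDet a y t` of the weights `t ^ (y j - a i) / (y j - a i)!`. Here this is proved without path
switching: the probability satisfies the forward equation up to errors that are quadratic in the
time step, it vanishes on the walls, and the determinant solves the same triangular system
(`eq_transDet_of_step`, `measureReal_inter_orderedUpTo_inter_atConf`). Starting the formula from
events of the past gives the law at several times (`measureReal_orderedUpTo_inter_iInter_atConf`).
Not meeting and staying in order agree up to a null set, since with high probability no cell of a
fine time grid contains two jumps (`measureReal_never_meet_diff_orderedUpTo`).

A gauge transformation turns the weights `t ^ (y - x) / (y - x)!` into the binomial weights
`binomTrans r x y = C(y, x) r ^ (y - x)`, with `r = t / T`. The first and the last determinant,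
from and to packed configurations, are then Vandermonde determinants; this gives the explicit law
and its normalisation `totalWeight`.

For the correlation functions, `binomTrans (q - p)` is the matrix of the change of basis from the
powers of `q - u` to the powers of `p - u` in the polynomials in `u` of degree less than `d = N +
n`. Through the basis `u ^ m (1 - u) ^ (d - 1 - m)`, it factors as `modeMatrix p * siteMatrix q`,
where `siteMatrix p` is the inverse of `modeMatrix p`. The transitions out of the initial and into
the final configuration factor through the first `n` elements of this basis, the modes `m < n`. By
iterated Cauchy–Binet and the Weinstein–Aronszajn identity, the correlation functions are then
minors of the kernel `modeMatrix p * (Q - 1_{p < q}) * siteMatrix q`, where `Q` is the projection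
onto the first `n` modes (`sum_chain_indicator_eq_det`, a form of the Eynard–Mehta theorem).

The double contour integral is this same matrix product. For the `t`-integral, the numerator is
expanded in powers of `t` by `siteMatrix q`, and the residues at `0` and `s` yield `Q - 1_{p < q}`
up to sign, the indicator recording whether the `t`-contour contains the `s`-contour. The
`s`-integral takes the residue at `p / (1 - p)`, which is an entry of `modeMatrix p` up to sign
(`busKernel_eq_spaceTimeKernel`).
-/

namespace BusModel

/-! ### Cauchy–Binet and Eynard–Mehta identities -/

/-- Configurations of `n` particles on the sites `0, …, d - 1`, listed in decreasing order. -/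
abbrev Conf (n d : ℕ) : Type := {x : Fin n → Fin d // StrictAnti x}

noncomputable instance (n d : ℕ) : Fintype (Conf n d) := Fintype.ofFinite _

section LinearAlgebra

variable {R : Type*} [CommRing R] {n d : ℕ}

lemma exists_strictAnti_comp_perm (x : Fin n → Fin d) (hx : Function.Injective x) :
    ∃ (y : Conf n d) (σ : Equiv.Perm (Fin n)), y.1 ∘ σ = x := by
  set τ : Equiv.Perm (Fin n) := Fin.revPerm.trans (Tuple.sort x) with hτ
  have hmono : Monotone (x ∘ Tuple.sort x) := Tuple.monotone_sort x
  have hanti : Antitone (x ∘ τ) := fun i j hij => hmono (Fin.rev_le_rev.2 hij)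
  refine ⟨⟨x ∘ τ, hanti.strictAnti_of_injective (hx.comp τ.injective)⟩, τ.symm, ?_⟩
  ext i
  simp

lemma conf_comp_perm_injective {y y' : Conf n d} {σ σ' : Equiv.Perm (Fin n)}
    (h : y.1 ∘ σ = y'.1 ∘ σ') : y = y' ∧ σ = σ' := by
  have hy : y = y' := by
    have hr : Set.range y.1 = Set.range y'.1 := by
      rw [← σ.surjective.range_comp y.1, h, σ'.surjective.range_comp]
    have h1 : StrictMono (fun i => OrderDual.toDual (y.1 i)) := fun i j hij => y.2 hij
    have h2 : StrictMono (fun i => OrderDual.toDual (y'.1 i)) := fun i j hij => y'.2 hij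
    have := (h1.range_inj h2).1 (by
      have e : ∀ z : Fin n → Fin d, Set.range (fun i => OrderDual.toDual (z i)) =
        OrderDual.toDual '' Set.range z := fun z => by rw [← Set.range_comp]; rfl
      rw [e, e, hr])
    exact Subtype.ext (funext fun i => OrderDual.toDual.injective (congrFun this i))
  subst hy
  refine ⟨rfl, Equiv.ext fun i => y.2.injective (congrFun h i)⟩

/-- **Cauchy–Binet formula**, summed over decreasing index maps. -/
theorem det_mul_eq_sum_conf (A : Matrix (Fin n) (Fin d) R) (B : Matrix (Fin d) (Fin n) R) :
    (A * B).det = ∑ x : Conf n d, (A.submatrix id x.1).det * (B.submatrix x.1 id).det := by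
  classical
  have h1 : (A * B).det = ∑ x : Fin n → Fin d, (∏ i, A i (x i)) * (B.submatrix x id).det := by
    have : (A * B) = fun i => ∑ k, A i k • B k := by
      ext i j; simp [Matrix.mul_apply]
    change (Matrix.detRowAlternating (R := R) (n := Fin n)).toMultilinearMap (A * B) = _
    rw [this, MultilinearMap.map_sum]
    refine Finset.sum_congr rfl fun x _ => ?_
    rw [MultilinearMap.map_smul_univ]
    rfl
  rw [h1]
  -- only the injective index maps contribute, and these are sorted
  have h2 : ∑ x : Fin n → Fin d, (∏ i, A i (x i)) * (B.submatrix x id).det =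
      ∑ x : Fin n → Fin d with Function.Injective x,
        (∏ i, A i (x i)) * (B.submatrix x id).det := by
    rw [Finset.sum_filter_of_ne]
    intro x _ hne
    by_contra hx
    obtain ⟨i, j, hij, hne'⟩ := Function.not_injective_iff.1 hx
    refine hne ?_
    rw [Matrix.det_zero_of_row_eq hne' (by ext k; simp [hij]), mul_zero]
  have h3 : ∑ x : Fin n → Fin d with Function.Injective x,
        (∏ i, A i (x i)) * (B.submatrix x id).det =
      ∑ q : Conf n d × Equiv.Perm (Fin n),
        (∏ i, A i (q.1.1 (q.2 i))) * (B.submatrix (q.1.1 ∘ q.2) id).det := by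
    symm
    refine Finset.sum_bij (fun q _ => q.1.1 ∘ q.2) ?_ ?_ ?_ ?_
    · intro q _
      simpa using q.1.2.injective.comp q.2.injective
    · intro q _ q' _ h
      obtain ⟨h, h'⟩ := conf_comp_perm_injective h
      exact Prod.ext h h'
    · intro x hx
      obtain ⟨y, σ, h⟩ := exists_strictAnti_comp_perm x (by simpa using hx)
      exact ⟨(y, σ), Finset.mem_univ _, h⟩
    · intro q _
      rfl
  rw [h2, h3, Fintype.sum_prod_type]
  refine Finset.sum_congr rfl fun y _ => ?_
  have h4 : ∀ σ : Equiv.Perm (Fin n), (B.submatrix (y.1 ∘ σ) id).det =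
      (Equiv.Perm.sign σ : R) * (B.submatrix y.1 id).det := fun σ => by
    rw [← Matrix.det_permute]; rfl
  simp_rw [h4]
  rw [← Matrix.det_transpose (A.submatrix id y.1), Matrix.det_apply' (A.submatrix id y.1).transpose,
    Finset.sum_mul]
  refine Finset.sum_congr rfl fun σ _ => ?_
  simp only [Matrix.transpose_apply, Matrix.submatrix_apply, id]
  ring

lemma sum_prod_conf_diagonal (A : Matrix (Fin n) (Fin d) R) (B : Matrix (Fin d) (Fin n) R)
    (w : Fin d → R) :
    ∑ x : Conf n d, (A.submatrix id x.1).det * (∏ i, w (x.1 i)) * (B.submatrix x.1 id).det =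
      (A * Matrix.diagonal w * B).det := by
  rw [det_mul_eq_sum_conf]
  refine Finset.sum_congr rfl fun x _ => ?_
  congr 1
  have : (A * Matrix.diagonal w).submatrix id x.1 =
      (A.submatrix id x.1) * Matrix.diagonal (fun i => w (x.1 i)) := by
    ext i j; simp [Matrix.mul_diagonal]
  rw [this, Matrix.det_mul, Matrix.det_diagonal]

/-- Iterated Cauchy–Binet formula: the weighted sum over chains of configurations of products of
transition determinants is a single determinant of size `n`. -/
theorem sum_chain_eq_det (m : ℕ) (A B : Fin (m + 1) → Matrix (Fin d) (Fin d) R)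
    (w : Fin (m + 1) → Fin d → R) (S : Matrix (Fin n) (Fin d) R) (T : Matrix (Fin d) (Fin n) R) :
    ∑ x : Fin (m + 1) → Conf n d,
      ((S * B 0).submatrix id (x 0).1).det *
        (∏ l : Fin m, ((A l.castSucc * B l.succ).submatrix (x l.castSucc).1 (x l.succ).1).det) *
        ((A (Fin.last m) * T).submatrix (x (Fin.last m)).1 id).det * ∏ l, ∏ i, w l ((x l).1 i) =
      (S * (List.ofFn fun l => B l * Matrix.diagonal (w l) * A l).prod * T).det := by
  induction m generalizing S with
  | zero =>
    rw [← (Equiv.funUnique (Fin 1) (Conf n d)).symm.sum_comp]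
    have := sum_prod_conf_diagonal (S * B 0) (A 0 * T) (w 0)
    simp only [Matrix.mul_assoc] at this
    simp only [Matrix.mul_assoc, List.ofFn_succ, List.ofFn_zero, List.prod_cons, List.prod_nil,
      mul_one, ← this]
    refine Finset.sum_congr rfl fun x _ => ?_
    simp [mul_right_comm]
  | succ m ih =>
    rw [← (Fin.consEquiv fun _ => Conf n d).sum_comp, Fintype.sum_prod_type, Finset.sum_comm]
    have key := ih (fun l => A l.succ) (fun l => B l.succ) (fun l => w l.succ)
      (S * B 0 * Matrix.diagonal (w 0) * A 0)
    rw [List.ofFn_succ, List.prod_cons]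
    have e : S * (B 0 * Matrix.diagonal (w 0) * A 0 *
        (List.ofFn fun l : Fin (m + 1) => B l.succ * Matrix.diagonal (w l.succ) * A l.succ).prod) *
          T = S * B 0 * Matrix.diagonal (w 0) * A 0 *
        (List.ofFn fun l : Fin (m + 1) => B l.succ * Matrix.diagonal (w l.succ) * A l.succ).prod
          * T := by
      simp only [Matrix.mul_assoc]
    rw [e, ← key]
    refine Finset.sum_congr rfl fun x _ => ?_
    have h0 := sum_prod_conf_diagonal (S * B 0) (A 0 * (B 1).submatrix id (x 0).1) (w 0)
    have h1 : ∀ y : Fin n → Fin d, (A 0 * (B 1).submatrix id (x 0).1).submatrix y id =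
        (A 0 * B 1).submatrix y (x 0).1 := fun y => by
      ext; simp [Matrix.mul_apply]
    have h2 : S * B 0 * Matrix.diagonal (w 0) * (A 0 * (B 1).submatrix id (x 0).1) =
        (S * B 0 * Matrix.diagonal (w 0) * A 0 * B 1).submatrix id (x 0).1 := by
      rw [← Matrix.mul_assoc]
      ext; simp [Matrix.mul_apply]
    simp only [h1] at h0
    rw [h2] at h0
    simp only [Fin.succ_zero_eq_one]
    rw [← h0, Finset.sum_mul, Finset.sum_mul, Finset.sum_mul]
    refine Finset.sum_congr rfl fun y _ => ?_
    simp only [Fin.consEquiv_apply, Fin.cons_zero, Fin.prod_univ_succ (n := m), Fin.castSucc_zero,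
      Fin.prod_univ_succ (n := m + 1), Fin.cons_succ, ← Fin.succ_castSucc, ← Fin.succ_last,
      Fin.succ_zero_eq_one]
    ring

/-- The inclusion of the first `n` coordinates, as an `n × d` matrix. -/
def firstCoords (R : Type*) [CommRing R] (n d : ℕ) : Matrix (Fin n) (Fin d) R :=
  Matrix.of fun i j => if (i : ℕ) = j then 1 else 0

lemma firstCoords_mul_transpose (h : n ≤ d) :
    firstCoords R n d * (firstCoords R n d).transpose = 1 := by
  ext i j
  rw [Matrix.mul_apply, Finset.sum_eq_single (⟨i, i.2.trans_le h⟩ : Fin d)]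
  · simp [firstCoords, Matrix.one_apply, Fin.ext_iff, eq_comm]
  · intro b _ hb
    have : ¬ (i : ℕ) = b := fun h => hb (Fin.ext h.symm)
    simp [firstCoords, this]
  · simp

lemma transpose_mul_firstCoords :
    (firstCoords R n d).transpose * firstCoords R n d =
      Matrix.diagonal fun y : Fin d => if (y : ℕ) < n then (1 : R) else 0 := by
  ext y y'
  rw [Matrix.mul_apply]
  simp only [firstCoords, Matrix.transpose_apply, Matrix.of_apply, Matrix.diagonal_apply,
    mul_ite, mul_one, mul_zero]
  by_cases hy : (y : ℕ) < n
  · rw [Finset.sum_eq_single ⟨y, hy⟩]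
    · simp [hy, Fin.ext_iff]
    · intro c _ hc
      have : ¬ (c : ℕ) = y := fun h => hc (Fin.ext h)
      simp [this]
    · simp
  · rw [Finset.sum_eq_zero]
    · simp [hy]
    · intro c _
      have : ¬ (c : ℕ) = y := fun h => hy (h ▸ c.2)
      simp [this]

/-- The space-time kernel `A i (Q - 1_{i < j}) B j` on `Fin k × Fin d`, where `Q` is the projection
onto the first `n` coordinates. -/
def spaceTimeKernel {k : ℕ} (n : ℕ) (A B : Fin k → Matrix (Fin d) (Fin d) R) :
    Matrix (Fin k × Fin d) (Fin k × Fin d) R :=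
  Matrix.of fun z w =>
    (A z.1 * ((firstCoords R n d).transpose * firstCoords R n d -
      (if z.1 < w.1 then 1 else 0 : Matrix (Fin d) (Fin d) R)) *
      B w.1) z.2 w.2

/-- Telescoping for tails of an ordered product of matrices `1 + G j`. -/
lemma sum_mul_prod_drop {k : ℕ} (G : Fin k → Matrix (Fin d) (Fin d) R) (i : ℕ) (hi : i ≤ k) :
    ∑ j : Fin k, (if i ≤ j then G j * ((List.ofFn fun l => 1 + G l).drop (j + 1)).prod else 0) =
      ((List.ofFn fun l => 1 + G l).drop i).prod - 1 := by
  induction hi using Nat.decreasingInduction with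
  | self =>
    rw [List.drop_of_length_le (by simp)]
    simp only [List.prod_nil, sub_self]
    exact Finset.sum_eq_zero fun j _ => if_neg (by omega)
  | of_succ i hi ih =>
    have e : ∀ j : Fin k,
        (if i ≤ j then G j * ((List.ofFn fun l => 1 + G l).drop (j + 1)).prod else 0) =
        (if i + 1 ≤ j then G j * ((List.ofFn fun l => 1 + G l).drop (j + 1)).prod else 0) +
        (if j = ⟨i, hi⟩ then G j * ((List.ofFn fun l => 1 + G l).drop (j + 1)).prod else 0) := by
      intro j
      by_cases h : j = ⟨i, hi⟩
      · subst h; simp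
      · have h' : (j : ℕ) ≠ i := fun h' => h (Fin.ext h')
        by_cases h2 : i ≤ j
        · rw [if_pos h2, if_pos (by omega), if_neg h, add_zero]
        · rw [if_neg h2, if_neg (by omega), if_neg h, add_zero]
    simp_rw [e, Finset.sum_add_distrib, ih]
    rw [Finset.sum_ite_eq' Finset.univ, if_pos (Finset.mem_univ _),
      List.drop_eq_getElem_cons (i := i) (by simpa using hi), List.prod_cons]
    simp only [List.getElem_ofFn]
    rw [add_mul, one_mul]
    abel

lemma det_one_sub_of_lt {k : ℕ} (r : Matrix (Fin k × Fin d) (Fin k × Fin d) R)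
    (h : ∀ z w, ¬ z.1 < w.1 → r z w = 0) : (1 - r).det = 1 := by
  have ht : (1 - r).BlockTriangular Prod.fst := by
    intro z w hzw
    have hne : z ≠ w := fun e => by simp [e] at hzw
    simp [Matrix.one_apply_ne hne, h z w (not_lt.2 hzw.le)]
  rw [ht.det_fintype]
  refine Finset.prod_eq_one fun a _ => ?_
  rw [show (1 - r).toSquareBlock Prod.fst a = 1 from ?_, Matrix.det_one]
  ext z w
  have : r z.1 w.1 = 0 := h _ _ (by simp [z.2, w.2])
  simp [Matrix.toSquareBlock_def, this, Matrix.one_apply, Subtype.ext_iff]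

/-- Eynard–Mehta identity: the Fredholm-type determinant of the space-time kernel, of size `k * d`,
reduces to a determinant of size `n`. The strictly upper triangular part of the kernel is split off
as a unipotent factor; the remaining perturbation has rank `n`. -/
theorem det_one_add_diagonal_mul_spaceTimeKernel {k : ℕ} (hnd : n ≤ d)
    (A B : Fin k → Matrix (Fin d) (Fin d) R) (g : Fin k → Fin d → R) :
    (1 + Matrix.diagonal (fun z : Fin k × Fin d => g z.1 z.2) * spaceTimeKernel n A B).det =
      (firstCoords R n d * (List.ofFn fun l => 1 + B l * Matrix.diagonal (g l) * A l).prod *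
        (firstCoords R n d).transpose).det := by
  set J := firstCoords R n d with hJ
  set G : Fin k → Matrix (Fin d) (Fin d) R := fun l => B l * Matrix.diagonal (g l) * A l with hG
  set P : ℕ → Matrix (Fin d) (Fin d) R := fun i => ((List.ofFn fun l => 1 + G l).drop i).prod
    with hP
  -- the strictly upper triangular part
  set r : Matrix (Fin k × Fin d) (Fin k × Fin d) R := Matrix.of fun z w =>
    if z.1 < w.1 then (Matrix.diagonal (g z.1) * A z.1 * B w.1) z.2 w.2 else 0 with hr
  set col : Matrix (Fin k × Fin d) (Fin n) R := Matrix.of fun z c =>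
    (Matrix.diagonal (g z.1) * A z.1 * J.transpose) z.2 c with hcol
  set row : Matrix (Fin n) (Fin k × Fin d) R := Matrix.of fun c w => (J * B w.1) c w.2 with hrow
  set H : Matrix (Fin k × Fin d) (Fin n) R := Matrix.of fun z c =>
    (Matrix.diagonal (g z.1) * A z.1 * P (z.1 + 1) * J.transpose) z.2 c with hH
  have h1 : 1 + Matrix.diagonal (fun z : Fin k × Fin d => g z.1 z.2) * spaceTimeKernel n A B =
      1 - r + col * row := by
    rw [sub_add_eq_add_sub, add_sub_assoc]
    congr 1
    ext z w
    have e1 : (col * row) z w =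
        (Matrix.diagonal (g z.1) * (A z.1 * (J.transpose * J) * B w.1)) z.2 w.2 := by
      have : Matrix.diagonal (g z.1) * (A z.1 * (J.transpose * J) * B w.1) =
        (Matrix.diagonal (g z.1) * A z.1 * J.transpose) * (J * B w.1) := by
          simp only [Matrix.mul_assoc]
      rw [this, Matrix.mul_apply, Matrix.mul_apply]
      rfl
    rw [Matrix.sub_apply, e1, Matrix.diagonal_mul, Matrix.diagonal_mul]
    simp only [spaceTimeKernel, Matrix.of_apply, hr, ← hJ, Matrix.sub_mul,
      Matrix.sub_apply, mul_sub]
    congr 1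
    split_ifs
    · rw [Matrix.mul_one, Matrix.mul_assoc, Matrix.diagonal_mul]
    · simp
  have h2 : (1 - r) * H = col := by
    rw [Matrix.sub_mul, Matrix.one_mul]
    ext z c
    have e1 : (r * H) z c = (Matrix.diagonal (g z.1) * A z.1 *
        (∑ j : Fin k, if (z.1 : ℕ) + 1 ≤ j then G j * P (j + 1) else 0) * J.transpose) z.2 c := by
      rw [Matrix.mul_apply, Fintype.sum_prod_type, Matrix.mul_sum, Matrix.sum_mul,
        Matrix.sum_apply]
      refine Finset.sum_congr rfl fun j _ => ?_
      by_cases hj : z.1 < j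
      · have hj' : (z.1 : ℕ) + 1 ≤ j := hj
        rw [if_pos hj']
        have : Matrix.diagonal (g z.1) * A z.1 * (G j * P (j + 1)) * J.transpose =
          (Matrix.diagonal (g z.1) * A z.1 * B j) *
            (Matrix.diagonal (g j) * A j * P (j + 1) * J.transpose) := by
              simp only [hG, Matrix.mul_assoc]
        rw [this, Matrix.mul_apply]
        refine Finset.sum_congr rfl fun y _ => ?_
        simp [hr, hH, hj]
      · have hj' : ¬ (z.1 : ℕ) + 1 ≤ j := hj
        rw [if_neg hj']
        simp [hr, hj]
    rw [Matrix.sub_apply, e1, sum_mul_prod_drop G _ z.1.2]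
    simp only [hH, hcol, Matrix.of_apply, ← Matrix.sub_apply, hP]
    rw [← Matrix.sub_mul, ← Matrix.mul_sub, sub_sub_cancel, Matrix.mul_one]
  have h3 : row * H = J * (P 0 - 1) * J.transpose := by
    ext c c'
    have := sum_mul_prod_drop G 0 (Nat.zero_le _)
    simp only [hP]
    rw [← this, Matrix.mul_apply, Fintype.sum_prod_type, Matrix.mul_sum, Matrix.sum_mul,
        Matrix.sum_apply]
    refine Finset.sum_congr rfl fun j _ => ?_
    rw [if_pos (Nat.zero_le _)]
    have : J * (G j * P (j + 1)) * J.transpose =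
          (J * B j) * (Matrix.diagonal (g j) * A j * P (j + 1) * J.transpose) := by
              simp only [hG, Matrix.mul_assoc]
    simp only [hP] at this
    rw [this, Matrix.mul_apply]
    rfl
  rw [h1, ← h2, Matrix.mul_assoc, show (1 - r) + (1 - r) * (H * row) = (1 - r) * (1 + H * row) by
    rw [Matrix.mul_add, Matrix.mul_one], Matrix.det_mul, det_one_sub_of_lt r ?_, one_mul,
    Matrix.det_one_add_mul_comm, h3, Matrix.mul_sub, Matrix.sub_mul, Matrix.mul_one,
    hJ, firstCoords_mul_transpose hnd, ← hJ, add_sub_cancel]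
  · rfl
  · intro z w hzw
    simp [hr, hzw]

/-- Correlation sums of a chain of transition determinants are minors of the space-time kernel, up
to the total mass. The start and end matrices factor through the first `n` coordinates. The proof
computes the generating function `∏ a, (ε + 1_a)`, where `1_a` indicates that the point `z a` is
occupied, and sets `ε = 0` at the end. -/
theorem sum_chain_indicator_eq_det {K : Type*} [Field K] [Infinite K] {n d m r : ℕ} (hnd : n ≤ d)
    (A B : Fin (m + 1) → Matrix (Fin d) (Fin d) K) (hBA : ∀ l, B l * A l = 1)
    (S' T' : Matrix (Fin n) (Fin n) K) (z : Fin r → Fin (m + 1) × Fin d)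
    (hz : Function.Injective z) :
    ∑ x : Fin (m + 1) → Conf n d,
      ((S' * firstCoords K n d * B 0).submatrix id (x 0).1).det *
        (∏ l : Fin m, ((A l.castSucc * B l.succ).submatrix (x l.castSucc).1 (x l.succ).1).det) *
        ((A (Fin.last m) * ((firstCoords K n d).transpose * T')).submatrix
          (x (Fin.last m)).1 id).det *
        (open Classical in if ∀ a, ∃ i, (x (z a).1).1 i = (z a).2 then 1 else 0) =
      (S' * T').det * ((spaceTimeKernel n A B).submatrix z z).det := by
  classical
  set J := firstCoords K n d with hJ
  set W : (Fin (m + 1) → Conf n d) → K := fun x =>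
    ((S' * J * B 0).submatrix id (x 0).1).det *
        (∏ l : Fin m, ((A l.castSucc * B l.succ).submatrix (x l.castSucc).1 (x l.succ).1).det) *
        ((A (Fin.last m) * (J.transpose * T')).submatrix
          (x (Fin.last m)).1 id).det with hW
  -- the generating function, first for `ε ≠ 0`
  have main : ∀ ε : K, ε ≠ 0 →
      ∑ x, W x * ∏ a, (ε + if ∃ i, (x (z a).1).1 i = (z a).2 then 1 else 0) =
      (S' * T').det *
        (Matrix.diagonal (fun _ => ε) + (spaceTimeKernel n A B).submatrix z z).det := by
    intro ε hε
    set g : Fin (m + 1) → Fin d → K := fun l y => if (l, y) ∈ Set.range z then ε⁻¹ else 0 with hg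
    have e1 : ∀ x : Fin (m + 1) → Conf n d,
        ∏ a, (ε + if ∃ i, (x (z a).1).1 i = (z a).2 then 1 else 0) =
          ε ^ r * ∏ l, ∏ i, (1 + g l ((x l).1 i)) := by
      intro x
      have hinj : Function.Injective (fun q : Fin (m + 1) × Fin n => (q.1, (x q.1).1 q.2)) := by
        rintro ⟨l, i⟩ ⟨l', i'⟩ h
        obtain ⟨rfl, h⟩ := Prod.mk.inj h
        exact Prod.ext rfl ((x l).2.injective h)
      have e2 : ∏ l, ∏ i, (1 + g l ((x l).1 i)) =
          ∏ w : Fin (m + 1) × Fin d,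
            if ∃ i, (x w.1).1 i = w.2 then (1 + g w.1 w.2) else 1 := by
        rw [← Fintype.prod_prod_type' (f := fun l i => 1 + g l ((x l).1 i)),
          ← Finset.prod_filter,
          ← Finset.prod_image (s := Finset.univ) (g := fun q : Fin (m + 1) × Fin n =>
            (q.1, (x q.1).1 q.2)) (f := fun w => 1 + g w.1 w.2) hinj.injOn]
        refine Finset.prod_congr ?_ fun _ _ => rfl
        ext ⟨l, y⟩
        simp
      have e3 : ∏ a, (if ∃ i, (x (z a).1).1 i = (z a).2 then (1 + ε⁻¹) else 1) =
          ∏ w : Fin (m + 1) × Fin d,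
            if ∃ i, (x w.1).1 i = w.2 then (1 + g w.1 w.2) else 1 := by
        rw [← Finset.prod_image (s := Finset.univ) (g := z)
          (f := fun w => if ∃ i, (x w.1).1 i = w.2 then (1 + ε⁻¹) else 1) hz.injOn]
        symm
        refine (Finset.prod_subset (Finset.subset_univ _) ?_).symm.trans
          (Finset.prod_congr rfl ?_)
        · intro w _ hw
          have : g w.1 w.2 = 0 := if_neg (by simpa using hw)
          simp [this]
        · intro w hw
          have : g w.1 w.2 = ε⁻¹ := if_pos (by simpa using hw)
          simp [this]
      rw [e2, ← e3, ← Fin.prod_const, ← Finset.prod_mul_distrib]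
      refine Finset.prod_congr rfl fun a _ => ?_
      split_ifs
      · field_simp
      · simp
    have e4 := sum_chain_eq_det m A B (fun l y => 1 + g l y) (S' * J) (J.transpose * T')
    have e5 : ∀ l, B l * Matrix.diagonal (fun y => 1 + g l y) * A l =
        1 + B l * Matrix.diagonal (g l) * A l := by
      intro l
      rw [show Matrix.diagonal (fun y => 1 + g l y) = 1 + Matrix.diagonal (g l) by
        rw [← Matrix.diagonal_one, Matrix.diagonal_add], Matrix.mul_add, Matrix.add_mul,
        Matrix.mul_one, hBA]
    have e6 : Matrix.diagonal (fun w : Fin (m + 1) × Fin d => g w.1 w.2) =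
        (Matrix.of fun (w : Fin (m + 1) × Fin d) (a : Fin r) => if w = z a then ε⁻¹ else 0) *
        Matrix.of fun (a : Fin r) (w : Fin (m + 1) × Fin d) => if w = z a then (1 : K) else 0 := by
      ext w w'
      rw [Matrix.mul_apply]
      simp only [Matrix.of_apply, Matrix.diagonal_apply, hg, mul_ite, mul_one, mul_zero]
      by_cases hw : w ∈ Set.range z
      · obtain ⟨a, rfl⟩ := hw
        rw [Finset.sum_eq_single a]
        · simp [eq_comm]
        · intro b _ hb
          rw [if_neg (fun h => hb (hz h).symm), ite_self]
        · simp
      · rw [Finset.sum_eq_zero]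
        · simp [hw]
        · intro b _
          rw [if_neg (fun h : w = z b => hw ⟨b, h.symm⟩), ite_self]
    have e7 := det_one_add_diagonal_mul_spaceTimeKernel hnd A B g
    have e8 : (1 + Matrix.diagonal (fun w : Fin (m + 1) × Fin d => g w.1 w.2) *
        spaceTimeKernel n A B).det = (1 + ε⁻¹ • (spaceTimeKernel n A B).submatrix z z).det := by
      rw [e6, Matrix.mul_assoc, Matrix.det_one_add_mul_comm]
      congr 2
      ext a b
      simp [Matrix.mul_apply]
      ring
    simp_rw [e1]
    have e9 : ε ^ r * (1 + ε⁻¹ • (spaceTimeKernel n A B).submatrix z z).det =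
        (Matrix.diagonal (fun _ => ε) + (spaceTimeKernel n A B).submatrix z z).det := by
      have := Matrix.det_smul (1 + ε⁻¹ • (spaceTimeKernel n A B).submatrix z z) ε
      rw [Fintype.card_fin] at this
      rw [← this, smul_add, smul_smul, mul_inv_cancel₀ hε, one_smul, Matrix.smul_one_eq_diagonal]
    have e10 : ∑ x, W x * (ε ^ r * ∏ l, ∏ i, (1 + g l ((x l).1 i))) =
        ε ^ r * ∑ x, W x * ∏ l, ∏ i, (1 + g l ((x l).1 i)) := by
      rw [Finset.mul_sum]
      exact Finset.sum_congr rfl fun _ _ => by ring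
    have e11 : ∀ X : Matrix (Fin d) (Fin d) K,
        (S' * J * X * (J.transpose * T')).det = (S' * T').det * (J * X * J.transpose).det := by
      intro X
      rw [show S' * J * X * (J.transpose * T') = S' * (J * X * J.transpose) * T' by
        simp only [Matrix.mul_assoc], Matrix.det_mul, Matrix.det_mul, Matrix.det_mul]
      ring
    rw [e10, e4, e11, ← e9, mul_left_comm, ← e8, e7]
    simp_rw [e5]
    rfl
  -- both sides are polynomials in `ε` agreeing off `0`
  have poly : (∑ x, Polynomial.C (W x) * ∏ a, (Polynomial.X + Polynomial.C
        (if ∃ i, (x (z a).1).1 i = (z a).2 then 1 else 0))) =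
      Polynomial.C (S' * T').det * (Matrix.diagonal (fun _ => Polynomial.X) +
        ((spaceTimeKernel n A B).submatrix z z).map Polynomial.C).det := by
    refine Polynomial.eq_of_infinite_eval_eq _ _ ((Set.finite_singleton (0 : K)).infinite_compl.mono
      fun ε hε => ?_)
    have := main ε hε
    simp only [Set.mem_ofPred_eq, Polynomial.eval_finsetSum, Polynomial.eval_mul,
      Polynomial.eval_C, Polynomial.eval_prod, Polynomial.eval_add, Polynomial.eval_X]
    rw [this]
    congr 1
    rw [← Polynomial.coe_evalRingHom, RingHom.map_det]
    congr 1
    ext a b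
    by_cases hab : a = b <;> simp [hab]
  have h0 := congrArg (Polynomial.eval 0) poly
  simp only [Polynomial.eval_finsetSum, Polynomial.eval_mul,
      Polynomial.eval_C, Polynomial.eval_prod, Polynomial.eval_add, Polynomial.eval_X,
      zero_add] at h0
  rw [← Polynomial.coe_evalRingHom, RingHom.map_det] at h0
  convert! h0 using 2
  · rw [Finset.prod_ite_zero]
    simp [hW]
  · congr 1
    ext a b
    by_cases hab : a = b <;> simp [hab]

end LinearAlgebra

/-! ### Binomial bases of polynomials -/

section BinomialBases

open Polynomial

variable {K : Type*} [Field K]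

/-- The polynomial `(p - v) ^ m * (1 - p + v) ^ (d - 1 - m)` in `v`, i.e.
`u ^ m * (1 - u) ^ (d - 1 - m)` written in the variable `v = p - u`. -/
noncomputable def modePoly (d : ℕ) (p : K) (m : ℕ) : K[X] :=
  (C p - X) ^ m * (C (1 - p) + X) ^ (d - 1 - m)

/-- The polynomial `(q - (1 - q) t) ^ y * (1 + t) ^ (d - 1 - y)` in `t`, i.e.
`(q - u) ^ y` for `u = t / (1 + t)`, up to the factor `(1 + t) ^ (d - 1)`. -/
noncomputable def sitePoly (d : ℕ) (q : K) (y : ℕ) : K[X] :=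
  (C q - C (1 - q) * X) ^ y * (1 + X) ^ (d - 1 - y)

/-- The matrix expanding the binomial basis `u ^ m * (1 - u) ^ (d - 1 - m)` of the polynomials of
degree `< d` in powers of `p - u`. -/
noncomputable def modeMatrix (d : ℕ) (p : K) : Matrix (Fin d) (Fin d) K :=
  Matrix.of fun x m => (modePoly d p m).coeff x

/-- The matrix expanding the powers of `q - u` in the basis `u ^ m * (1 - u) ^ (d - 1 - m)`. -/
noncomputable def siteMatrix (d : ℕ) (q : K) : Matrix (Fin d) (Fin d) K :=
  Matrix.of fun m y => (sitePoly d q y).coeff m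

/-- `binomTrans r x y = C(y, x) r ^ (y - x)`, the coefficient of `v ^ x` in `(r + v) ^ y`. -/
def binomTrans (r : K) (x y : ℕ) : K := y.choose x * r ^ (y - x)

lemma natDegree_modePoly_lt {d : ℕ} (p : K) (m : Fin d) : (modePoly d p m).natDegree < d := by
  have h1 : ((C p - X : K[X]) ^ (m : ℕ)).natDegree ≤ m := by
    compute_degree
  have h2 : ((C (1 - p) + X : K[X]) ^ (d - 1 - m)).natDegree ≤ d - 1 - m := by
    compute_degree
  have := m.2
  exact (natDegree_mul_le_of_le h1 h2).trans_lt (by omega)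

lemma natDegree_sitePoly_lt {d : ℕ} (q : K) (y : Fin d) : (sitePoly d q y).natDegree < d := by
  have h1 : ((C q - C (1 - q) * X : K[X]) ^ (y : ℕ)).natDegree ≤ y := by
    compute_degree
  have h2 : ((1 + X : K[X]) ^ (d - 1 - y)).natDegree ≤ d - 1 - y := by
    compute_degree
  have := y.2
  exact (natDegree_mul_le_of_le h1 h2).trans_lt (by omega)

/-- Expansion of `(p - v) ^ m * (1 - p + v) ^ (d - 1 - m)` in powers of `v`. -/
lemma sum_modeMatrix_mul_pow {d : ℕ} (p v : K) (m : Fin d) :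
    ∑ k, modeMatrix d p k m * v ^ (k : ℕ) = (p - v) ^ (m : ℕ) * (1 - p + v) ^ (d - 1 - m) := by
  have h := eval_eq_sum_range' (natDegree_modePoly_lt p m) v
  rw [← Fin.sum_univ_eq_sum_range (fun k => (modePoly d p m).coeff k * v ^ k)] at h
  simp only [modeMatrix, Matrix.of_apply, ← h]
  simp [modePoly]

/-- Expansion of `(q - (1 - q) t) ^ y * (1 + t) ^ (d - 1 - y)` in powers of `t`. -/
lemma sum_siteMatrix_mul_pow {d : ℕ} (q t : K) (y : Fin d) :
    ∑ m, siteMatrix d q m y * t ^ (m : ℕ) =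
      (q - (1 - q) * t) ^ (y : ℕ) * (1 + t) ^ (d - 1 - y) := by
  have h := eval_eq_sum_range' (natDegree_sitePoly_lt q y) t
  rw [← Fin.sum_univ_eq_sum_range (fun k => (sitePoly d q y).coeff k * t ^ k)] at h
  simp only [siteMatrix, Matrix.of_apply, ← h]
  simp [sitePoly]

/-- The change of basis from powers of `q - u` to powers of `p - u`. -/
theorem modeMatrix_mul_siteMatrix_apply [Infinite K] {d : ℕ} (p q : K) (x y : Fin d) :
    (modeMatrix d p * siteMatrix d q) x y = binomTrans (q - p) x y := by
  have key : ∑ m : Fin d, C (siteMatrix d q m y) * modePoly d p m =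
      (C (q - p) + X) ^ (y : ℕ) := by
    -- substitute `t = u / (1 - u)` with `u = p - v`, off the pole `u = 1`
    refine eq_of_infinite_eval_eq _ _ ((Set.finite_singleton (p - 1)).infinite_compl.mono
      fun v hv => ?_)
    have hb : 1 - p + v ≠ 0 := fun h => hv (by
      rw [Set.mem_singleton_iff]; linear_combination h)
    have hd : d - 1 = y + (d - 1 - y) := by have := y.2; omega
    simp only [Set.mem_ofPred_eq, eval_finsetSum, modePoly, eval_mul, eval_pow, eval_add, eval_sub,
      eval_C, eval_X]
    have h := sum_siteMatrix_mul_pow q ((p - v) / (1 - p + v)) y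
    have h' := congrArg (fun s => (1 - p + v) ^ (d - 1) * s) h
    simp only [Finset.mul_sum] at h'
    calc ∑ m : Fin d, siteMatrix d q m y * ((p - v) ^ (m : ℕ) * (1 - p + v) ^ (d - 1 - m))
        = ∑ m : Fin d, (1 - p + v) ^ (d - 1) *
            (siteMatrix d q m y * ((p - v) / (1 - p + v)) ^ (m : ℕ)) := by
          refine Finset.sum_congr rfl fun m _ => ?_
          have hm : d - 1 = m + (d - 1 - m) := by have := m.2; omega
          rw [div_pow]
          conv_rhs => rw [hm, pow_add]
          field_simp
      _ = _ := h'
      _ = ((1 - p + v) * (q - (1 - q) * ((p - v) / (1 - p + v)))) ^ (y : ℕ) *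
            ((1 - p + v) * (1 + (p - v) / (1 - p + v))) ^ (d - 1 - y) := by
          conv_lhs => rw [hd, pow_add]
          rw [mul_pow, mul_pow]
          have : (y : ℕ) + (d - 1 - y) - y = d - 1 - y := by omega
          rw [this]
          ring
      _ = (q - p + v) ^ (y : ℕ) := by
          rw [show (1 - p + v) * (q - (1 - q) * ((p - v) / (1 - p + v))) = q - p + v by
            field_simp; ring, show (1 - p + v) * (1 + (p - v) / (1 - p + v)) = 1 by
            field_simp; ring, one_pow, mul_one]
  have h := congrArg (fun P => P.coeff x) key
  simp only [finsetSum_coeff, coeff_C_mul] at h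
  rw [Matrix.mul_apply]
  simp only [modeMatrix, Matrix.of_apply] at h ⊢
  rw [add_comm, coeff_X_add_C_pow] at h
  rw [binomTrans, mul_comm (_ : K) (_ ^ _), ← h]
  exact Finset.sum_congr rfl fun m _ => mul_comm _ _

lemma siteMatrix_mul_modeMatrix [Infinite K] (d : ℕ) (p : K) :
    siteMatrix d p * modeMatrix d p = 1 := by
  rw [mul_eq_one_comm]
  ext x y
  rw [modeMatrix_mul_siteMatrix_apply, sub_self, binomTrans]
  rcases lt_trichotomy x y with h | h | h
  · have : (y : ℕ) - x ≠ 0 := Nat.sub_ne_zero_of_lt h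
    simp [Matrix.one_apply_ne h.ne, this]
  · subst h; simp
  · simp [Matrix.one_apply_ne h.ne', Nat.choose_eq_zero_of_lt (Fin.lt_def.1 h)]

lemma modeMatrix_zero_apply_of_lt {d : ℕ} {x m : Fin d} (h : x < m) :
    modeMatrix d (0 : K) x m = 0 := by
  have : modePoly d (0 : K) m = X ^ (m : ℕ) * ((-1) ^ (m : ℕ) * (1 + X) ^ (d - 1 - m)) := by
    rw [modePoly, C_0, zero_sub, neg_pow]; simp; ring
  rw [modeMatrix, Matrix.of_apply, this, coeff_X_pow_mul', if_neg (by simpa using h)]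

lemma siteMatrix_one_apply_of_lt {d : ℕ} {m y : Fin d} (h : d - 1 - y < m) :
    siteMatrix d (1 : K) m y = 0 := by
  rw [siteMatrix, Matrix.of_apply, sitePoly]
  simp only [C_1, sub_self, C_0, zero_mul, sub_zero, one_pow, one_mul, coeff_one_add_X_pow]
  rw [Nat.choose_eq_zero_of_lt h, Nat.cast_zero]

/-- The correlation sums of the chain of binomial transition determinants, started from the packed
configuration `n - 1, …, 0` and ended at the packed configuration `d - 1, …, d - n`. -/
theorem sum_binomTrans_chain_indicator_eq_det [Infinite K] {n d m r : ℕ} (hnd : n ≤ d)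
    (p : Fin (m + 1) → K) (z : Fin r → Fin (m + 1) × Fin d) (hz : Function.Injective z) :
    ∑ x : Fin (m + 1) → Conf n d,
      (Matrix.of fun i j : Fin n => binomTrans (p 0) (n - 1 - i) ((x 0).1 j)).det *
        (∏ l : Fin m, (Matrix.of fun i j : Fin n =>
          binomTrans (p l.succ - p l.castSucc) ((x l.castSucc).1 i) ((x l.succ).1 j)).det) *
        (Matrix.of fun i j : Fin n =>
          binomTrans (1 - p (Fin.last m)) ((x (Fin.last m)).1 i) (d - 1 - j)).det *
        (open Classical in if ∀ a, ∃ i, (x (z a).1).1 i = (z a).2 then 1 else 0) =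
      (Matrix.of fun i j : Fin n => binomTrans (1 : K) (n - 1 - i) (d - 1 - j)).det *
        ((spaceTimeKernel n (fun l => modeMatrix d (p l))
          (fun l => siteMatrix d (p l))).submatrix z z).det := by
  classical
  set a : Fin n → Fin d := fun i => ⟨n - 1 - i, by have := i.2; omega⟩ with ha
  set b : Fin n → Fin d := fun j => ⟨d - 1 - j, by have := j.2; omega⟩ with hb
  set J := firstCoords K n d with hJ
  set ι : Fin n → Fin d := Fin.castLE hnd with hι
  have hJι : J = (1 : Matrix (Fin d) (Fin d) K).submatrix ι id := by
    ext i j; simp [hJ, firstCoords, Matrix.one_apply, hι, Fin.ext_iff]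
  have hJJ := transpose_mul_firstCoords (R := K) (n := n) (d := d)
  rw [← hJ] at hJJ
  -- the transitions from time `0` and to time `1` factor through the modes `m < n`
  set S : Matrix (Fin n) (Fin d) K := (modeMatrix d (0 : K)).submatrix a id with hS
  set T : Matrix (Fin d) (Fin n) K := (siteMatrix d (1 : K)).submatrix id b with hT
  have hSJ : S * J.transpose * J = S := by
    rw [Matrix.mul_assoc, hJJ]
    ext i y
    rw [Matrix.mul_diagonal]
    by_cases hy : (y : ℕ) < n
    · simp [hy]
    · have : S i y = 0 := modeMatrix_zero_apply_of_lt (by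
        simp only [ha, Fin.lt_def, id]; have := i.2; omega)
      simp [this]
  have hTJ : J.transpose * (J * T) = T := by
    rw [← Matrix.mul_assoc, hJJ]
    ext y j
    rw [Matrix.diagonal_mul]
    by_cases hy : (y : ℕ) < n
    · simp [hy]
    · have : T y j = 0 := siteMatrix_one_apply_of_lt (by
        simp only [hb, id]; have := j.2; have := y.2; omega)
      simp [this]
  have main := sum_chain_indicator_eq_det hnd (fun l => modeMatrix d (p l))
    (fun l => siteMatrix d (p l)) (fun l => siteMatrix_mul_modeMatrix d (p l))
    (S * J.transpose) (J * T) z hz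
  rw [← hJ, hSJ, hTJ] at main
  have e1 : S * J.transpose * (J * T) =
      Matrix.of fun i j : Fin n => binomTrans (1 : K) (n - 1 - i) (d - 1 - j) := by
    rw [← Matrix.mul_assoc, hSJ]
    ext i j
    have := modeMatrix_mul_siteMatrix_apply (0 : K) 1 (a i) (b j)
    rw [sub_zero] at this
    rw [Matrix.of_apply, ← this]
    simp [hS, hT, Matrix.mul_apply]
  have e2 : ∀ y : Fin n → Fin d, (S * siteMatrix d (p 0)).submatrix id y =
      Matrix.of fun i j : Fin n => binomTrans (p 0) (n - 1 - i) (y j) := by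
    intro y
    ext i j
    have := modeMatrix_mul_siteMatrix_apply (0 : K) (p 0) (a i) (y j)
    rw [sub_zero] at this
    rw [Matrix.of_apply, ← this]
    simp [hS, Matrix.mul_apply]
  have e3 : ∀ y : Fin n → Fin d, (modeMatrix d (p (Fin.last m)) * T).submatrix y id =
      Matrix.of fun i j : Fin n => binomTrans (1 - p (Fin.last m)) (y i) (d - 1 - j) := by
    intro y
    ext i j
    have := modeMatrix_mul_siteMatrix_apply (p (Fin.last m)) 1 (y i) (b j)
    rw [Matrix.of_apply, ← this]
    simp [hT, Matrix.mul_apply]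
  have e4 : ∀ (l : Fin m) (y y' : Fin n → Fin d),
      (modeMatrix d (p l.castSucc) * siteMatrix d (p l.succ)).submatrix y y' =
      Matrix.of fun i j : Fin n => binomTrans (p l.succ - p l.castSucc) (y i) (y' j) := by
    intro l y y'
    ext i j
    rw [Matrix.submatrix_apply, modeMatrix_mul_siteMatrix_apply]
    rfl
  rw [← e1, ← main]
  simp only [e2, e3, e4]

end BinomialBases

/-! ### Evaluation of the contour integrals -/

section Contours

namespace IsSimpleContour

variable {γ : ℝ → ℂ}

lemma intervalIntegrable_deriv (hγ : IsSimpleContour γ) :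
    IntervalIntegrable (deriv γ) volume 0 1 := by
  obtain ⟨S, -, -, B, hB⟩ := hγ.piecewise
  rw [intervalIntegrable_iff_integrableOn_Ioo_of_le zero_le_one]
  refine Measure.integrableOn_of_bounded (M := B) measure_Ioo_lt_top.ne
    (measurable_deriv γ).aestronglyMeasurable ?_
  rw [ae_restrict_iff' measurableSet_Ioo]
  have : ∀ᵐ u : ℝ, u ∉ (S : Set ℝ) :=
    compl_mem_ae_iff.2 (S.finite_toSet.measure_zero _)
  filter_upwards [this] with u hu hu'
  exact hB u ⟨hu', hu⟩

lemma intervalIntegrable (hγ : IsSimpleContour γ) {f : ℂ → ℂ}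
    (hf : ContinuousOn (fun u => f (γ u)) (Icc 0 1)) :
    IntervalIntegrable (fun u => f (γ u) * deriv γ u) volume 0 1 :=
  hγ.intervalIntegrable_deriv.continuousOn_mul (by rwa [uIcc_of_le zero_le_one])

/-- A function with a primitive along the contour integrates to `0`. -/
lemma contourIntegral_eq_zero (hγ : IsSimpleContour γ) {F f : ℂ → ℂ}
    (hF : ∀ u ∈ Icc (0 : ℝ) 1, HasDerivAt F (f (γ u)) (γ u))
    (hf : ContinuousOn (fun u => f (γ u)) (Icc 0 1)) : contourIntegral γ f = 0 := by
  obtain ⟨S, hS, -, -⟩ := hγ.piecewise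
  have h := integral_eq_of_hasDerivAt_off_countable (fun u => F (γ u))
    (fun u => f (γ u) * deriv γ u) (a := 0) (b := 1) S.countable_toSet ?_ ?_
    (hγ.intervalIntegrable hf)
  · rw [contourIntegral, h, hγ.closed, sub_self]
  · rw [uIcc_of_le zero_le_one]
    intro u hu
    exact (hF u hu).continuousAt.comp_continuousWithinAt (hγ.continuousOn u hu)
  · intro u hu
    rw [min_eq_left zero_le_one, max_eq_right zero_le_one] at hu
    exact (hF u (Ioo_subset_Icc_self hu.1)).comp u (hS u hu).hasDerivAt

end IsSimpleContour

lemma contourIntegral_congr {γ : ℝ → ℂ} {f g : ℂ → ℂ}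
    (h : ∀ u ∈ Icc (0 : ℝ) 1, f (γ u) = g (γ u)) : contourIntegral γ f = contourIntegral γ g :=
  intervalIntegral.integral_congr fun u hu => by
    rw [uIcc_of_le zero_le_one] at hu
    simp only [h u hu]

lemma contourIntegral_const_mul (γ : ℝ → ℂ) (c : ℂ) (f : ℂ → ℂ) :
    contourIntegral γ (fun z => c * f z) = c * contourIntegral γ f := by
  simp only [contourIntegral, mul_assoc]
  exact intervalIntegral.integral_const_mul _ _

lemma IsSimpleContour.contourIntegral_sum {γ : ℝ → ℂ} (hγ : IsSimpleContour γ) {ι : Type*}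
    (s : Finset ι) (f : ι → ℂ → ℂ)
    (hf : ∀ i ∈ s, ContinuousOn (fun u => f i (γ u)) (Icc 0 1)) :
    contourIntegral γ (fun z => ∑ i ∈ s, f i z) = ∑ i ∈ s, contourIntegral γ (f i) := by
  simp only [contourIntegral, Finset.sum_mul]
  exact intervalIntegral.integral_finsetSum fun i hi => hγ.intervalIntegrable (hf i hi)

lemma IsSimpleContour.contourIntegral_sub {γ : ℝ → ℂ} (hγ : IsSimpleContour γ) {f g : ℂ → ℂ}
    (hf : ContinuousOn (fun u => f (γ u)) (Icc 0 1))
    (hg : ContinuousOn (fun u => g (γ u)) (Icc 0 1)) :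
    contourIntegral γ (fun z => f z - g z) = contourIntegral γ f - contourIntegral γ g := by
  simp only [contourIntegral, sub_mul]
  exact intervalIntegral.integral_sub (hγ.intervalIntegrable hf) (hγ.intervalIntegrable hg)

lemma two_pi_I_mul_windingNumber (γ : ℝ → ℂ) (w : ℂ) :
    2 * (Real.pi : ℂ) * Complex.I * windingNumber γ w =
      contourIntegral γ fun z => 1 / (z - w) := by
  rw [windingNumber, mul_inv_cancel_left₀]
  simp [Real.pi_ne_zero]

lemma contourIntegral_const_mul_inv_sub {γ : ℝ → ℂ} {w v : ℂ} (hv : windingNumber γ w = v)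
    (c : ℂ) :
    contourIntegral γ (fun z => c * (1 / (z - w))) = 2 * (Real.pi : ℂ) * Complex.I * (c * v) := by
  rw [contourIntegral_const_mul, ← two_pi_I_mul_windingNumber, hv]
  ring

lemma IsSimpleContour.contourIntegral_zpow {γ : ℝ → ℂ} (hγ : IsSimpleContour γ)
    (h0 : ∀ u ∈ Icc (0 : ℝ) 1, γ u ≠ 0) (e : ℤ) (he : e ≠ -1) :
    contourIntegral γ (fun z => z ^ e) = 0 := by
  have he' : ((e : ℂ) + 1) ≠ 0 := by
    exact_mod_cast fun h => he (by omega)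
  refine hγ.contourIntegral_eq_zero (F := fun z => z ^ (e + 1) / (e + 1)) (fun u hu => ?_) ?_
  · have := (hasDerivAt_zpow (e + 1) (γ u) (Or.inl (h0 u hu))).div_const ((e : ℂ) + 1)
    convert! this using 1
    push_cast
    rw [mul_div_cancel_left₀ _ he', add_sub_cancel_right]
  · exact hγ.continuousOn.zpow₀ _ fun u hu => Or.inl (h0 u hu)

/-- The residue computation for `t ^ m / (t ^ n * (t - s))`, uniformly in the position of `s`. -/
lemma IsSimpleContour.pow_mul_contourIntegral {τ : ℝ → ℂ} (hτ : IsSimpleContour τ)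
    (h0 : GoesAround τ 0) {s w : ℂ} (hs : ∀ u ∈ Icc (0 : ℝ) 1, τ u ≠ s)
    (hw : windingNumber τ s = w) (n m : ℕ) :
    s ^ n * contourIntegral τ (fun t => t ^ m * t ^ (-(n : ℤ)) * (1 / (t - s))) =
      2 * (Real.pi : ℂ) * Complex.I * (s ^ m * (w - if m < n then 1 else 0)) := by
  have hts : ∀ u ∈ Icc (0 : ℝ) 1, τ u - s ≠ 0 := fun u hu => sub_ne_zero.2 (hs u hu)
  have hcont : ContinuousOn (fun u => 1 / (τ u - s)) (Icc 0 1) :=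
    continuousOn_const.div (hτ.continuousOn.sub continuousOn_const) hts
  have hcz : ∀ e : ℤ, ContinuousOn (fun u => τ u ^ e) (Icc 0 1) := fun e =>
    hτ.continuousOn.zpow₀ _ fun u hu => Or.inl (h0.1 u hu)
  rcases lt_or_ge m n with hmn | hmn
  · obtain ⟨k, rfl⟩ : ∃ k, n = m + (k + 1) := ⟨n - m - 1, by omega⟩
    rw [if_pos hmn, pow_add, mul_assoc, mul_left_comm _ (s ^ m), ← contourIntegral_const_mul]
    congr 1
    -- only the term `j = k` of the geometric sum has a residue
    have e : contourIntegral τ (fun t => s ^ (k + 1) *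
          (t ^ m * t ^ (-((m + (k + 1) : ℕ) : ℤ)) * (1 / (t - s)))) =
        contourIntegral τ (fun t => 1 * (1 / (t - s)) -
          ∑ j ∈ Finset.range (k + 1), s ^ (k - j) * t ^ ((j : ℤ) - (k + 1))) := by
      refine contourIntegral_congr fun u hu => ?_
      have h1 := h0.1 u hu
      have h2 := hts u hu
      have h3 : τ u ^ m * τ u ^ (-((m + (k + 1) : ℕ) : ℤ)) = (τ u ^ (k + 1))⁻¹ := by
        rw [zpow_neg, zpow_natCast, pow_add]
        field_simp
      have h4 : ∑ j ∈ Finset.range (k + 1), s ^ (k - j) * τ u ^ ((j : ℤ) - (k + 1)) =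
          (∑ j ∈ Finset.range (k + 1), τ u ^ j * s ^ (k + 1 - 1 - j)) * (τ u ^ (k + 1))⁻¹ := by
        rw [Finset.sum_mul]
        refine Finset.sum_congr rfl fun j _ => ?_
        rw [zpow_sub₀ h1, zpow_natCast]
        norm_cast
        rw [div_eq_mul_inv, Nat.add_sub_cancel]
        ring
      rw [h3, h4]
      have h5 := geom_sum₂_mul (τ u) s (k + 1)
      have h6 : (∑ j ∈ Finset.range (k + 1), τ u ^ j * s ^ (k + 1 - 1 - j)) =
          (τ u ^ (k + 1) - s ^ (k + 1)) / (τ u - s) := by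
        rw [← h5, mul_div_cancel_right₀ _ h2]
      rw [h6]
      field_simp
      ring
    rw [e, hτ.contourIntegral_sub (by simpa using hcont), contourIntegral_const_mul_inv_sub hw,
      hτ.contourIntegral_sum]
    · have h1 : ∀ j ∈ Finset.range (k + 1),
          contourIntegral τ (fun t => s ^ (k - j) * t ^ ((j : ℤ) - (k + 1))) =
            if j = k then 2 * (Real.pi : ℂ) * Complex.I else 0 := by
        intro j hj
        rw [contourIntegral_const_mul]
        split_ifs with h
        · subst h
          have := two_pi_I_mul_windingNumber τ 0
          rw [h0.2] at this
          simp only [Nat.sub_self, pow_zero, one_mul]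
          rw [← mul_one (2 * (Real.pi : ℂ) * Complex.I), this]
          refine contourIntegral_congr fun u _ => ?_
          rw [show (j : ℤ) - (j + 1) = -1 by ring, zpow_neg_one, sub_zero, one_div]
        · rw [hτ.contourIntegral_zpow h0.1 _ (by omega), mul_zero]
      rw [Finset.sum_congr rfl h1]
      simp
      ring
    · intro j _
      exact continuousOn_const.mul (hcz _)
    · exact continuousOn_finsetSum _ fun j _ => continuousOn_const.mul (hcz _)
  · obtain ⟨k, rfl⟩ : ∃ k, m = n + k := ⟨m - n, by omega⟩
    rw [if_neg (by omega), sub_zero, show 2 * (Real.pi : ℂ) * Complex.I * (s ^ (n + k) * w) =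
      s ^ n * (2 * (Real.pi : ℂ) * Complex.I * (s ^ k * w)) by ring]
    congr 1
    have e : contourIntegral τ (fun t => t ^ (n + k) * t ^ (-(n : ℤ)) * (1 / (t - s))) =
        contourIntegral τ (fun t => s ^ k * (1 / (t - s)) -
          ∑ j ∈ Finset.range k, (-s ^ (k - 1 - j)) * t ^ (j : ℤ)) := by
      refine contourIntegral_congr fun u hu => ?_
      have h1 := h0.1 u hu
      have h2 := hts u hu
      have h3 : τ u ^ (n + k) * τ u ^ (-(n : ℤ)) = τ u ^ k := by
        rw [zpow_neg, zpow_natCast, pow_add]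
        field_simp
      have h4 : ∑ j ∈ Finset.range k, (-s ^ (k - 1 - j)) * τ u ^ (j : ℤ) =
          -(∑ j ∈ Finset.range k, τ u ^ j * s ^ (k - 1 - j)) := by
        rw [← Finset.sum_neg_distrib]
        refine Finset.sum_congr rfl fun j _ => ?_
        rw [zpow_natCast]
        ring
      have h6 : (∑ j ∈ Finset.range k, τ u ^ j * s ^ (k - 1 - j)) =
          (τ u ^ k - s ^ k) / (τ u - s) := by
        rw [← geom_sum₂_mul (τ u) s k, mul_div_cancel_right₀ _ h2]
      rw [h3, h4, h6]
      field_simp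
      ring
    rw [e, hτ.contourIntegral_sub, contourIntegral_const_mul_inv_sub hw,
      hτ.contourIntegral_sum, Finset.sum_eq_zero, sub_zero]
    · intro j _
      rw [contourIntegral_const_mul, hτ.contourIntegral_zpow h0.1 _ (by omega), mul_zero]
    · intro j _
      exact continuousOn_const.mul (hcz _)
    · exact continuousOn_const.mul hcont
    · exact continuousOn_finsetSum _ fun j _ => continuousOn_const.mul (hcz _)

/-- The residue computation at `s = p / (1 - p)`: in the variable `u = s / (1 + s)` it extracts the
coefficient of `(p - u) ^ x` from `u ^ m * (1 - u) ^ (d - 1 - m)`. -/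
lemma IsSimpleContour.contourIntegral_eq_modeMatrix {σ : ℝ → ℂ} (hσ : IsSimpleContour σ) {p : ℂ}
    (hp : 1 - p ≠ 0) (h1 : GoesAround σ (p / (1 - p))) (h2 : LiesOutside σ (-1)) {d : ℕ}
    (x m : Fin d) :
    contourIntegral σ (fun s => s ^ (m : ℕ) /
      ((p - (1 - p) * s) ^ ((x : ℕ) + 1) * (1 + s) ^ (d - x))) =
      2 * (Real.pi : ℂ) * Complex.I * (-modeMatrix d p x m) := by
  have hs : ∀ u ∈ Icc (0 : ℝ) 1, 1 + σ u ≠ 0 := fun u hu h =>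
    h2.1 u hu (by linear_combination h)
  have ha : ∀ u ∈ Icc (0 : ℝ) 1, σ u - p / (1 - p) ≠ 0 := fun u hu => sub_ne_zero.2 (h1.1 u hu)
  have hpu : ∀ u ∈ Icc (0 : ℝ) 1, p - (1 - p) * σ u ≠ 0 := fun u hu h =>
    h1.1 u hu (by rw [eq_div_iff hp]; linear_combination -h)
  have hv : ∀ u ∈ Icc (0 : ℝ) 1,
      p - σ u / (1 + σ u) = (p - (1 - p) * σ u) / (1 + σ u) := fun u hu => by
    have := hs u hu
    field_simp
    ring
  have hv0 : ∀ u ∈ Icc (0 : ℝ) 1, p - σ u / (1 + σ u) ≠ 0 := fun u hu => by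
    rw [hv u hu]
    exact div_ne_zero (hpu u hu) (hs u hu)
  have hcs : ContinuousOn (fun u => 1 + σ u) (Icc 0 1) := continuousOn_const.add hσ.continuousOn
  have hcv : ContinuousOn (fun u => p - σ u / (1 + σ u)) (Icc 0 1) :=
    continuousOn_const.sub (hσ.continuousOn.div hcs hs)
  have hcz : ∀ e : ℤ, ContinuousOn
      (fun u => (p - σ u / (1 + σ u)) ^ e * (1 / (1 + σ u) ^ 2)) (Icc 0 1) := fun e =>
    (hcv.zpow₀ _ fun u hu => Or.inl (hv0 u hu)).mul
      (continuousOn_const.div (hcs.pow 2) fun u hu => pow_ne_zero _ (hs u hu))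
  have e : contourIntegral σ (fun s => s ^ (m : ℕ) /
      ((p - (1 - p) * s) ^ ((x : ℕ) + 1) * (1 + s) ^ (d - x))) =
      contourIntegral σ (fun s => ∑ k : Fin d, modeMatrix d p k m *
        ((p - s / (1 + s)) ^ ((k : ℤ) - (x + 1)) * (1 / (1 + s) ^ 2))) := by
    refine contourIntegral_congr fun u hu => ?_
    have hs' := hs u hu
    have hp' := hpu u hu
    have hx : d - x = (d - 1 - x) + 1 := by have := x.2; omega
    have hd : d - 1 = x + (d - 1 - x) := by have := x.2; omega
    have hd' : d - 1 = m + (d - 1 - m) := by have := m.2; omega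
    have e1 : ∀ k : Fin d, modeMatrix d p k m *
        ((p - σ u / (1 + σ u)) ^ ((k : ℤ) - (x + 1)) * (1 / (1 + σ u) ^ 2)) =
        modeMatrix d p k m * (p - σ u / (1 + σ u)) ^ (k : ℕ) *
          (((p - σ u / (1 + σ u)) ^ ((x : ℕ) + 1))⁻¹ * (1 / (1 + σ u) ^ 2)) := fun k => by
      rw [zpow_sub₀ (hv0 u hu), zpow_natCast]
      norm_cast
      rw [div_eq_mul_inv]
      ring
    simp_rw [e1]
    rw [← Finset.sum_mul, sum_modeMatrix_mul_pow, sub_sub_cancel,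
      show 1 - p + (p - σ u / (1 + σ u)) = 1 / (1 + σ u) by field_simp; ring, hv u hu, hx]
    have e2 : (1 + σ u) ^ (d - 1) = (1 + σ u) ^ (x : ℕ) * (1 + σ u) ^ (d - 1 - x) := by
      rw [← pow_add, ← hd]
    have e3 : (1 + σ u) ^ (d - 1) = (1 + σ u) ^ (m : ℕ) * (1 + σ u) ^ (d - 1 - m) := by
      rw [← pow_add, ← hd']
    have e4 : (σ u / (1 + σ u)) ^ (m : ℕ) * (1 / (1 + σ u)) ^ (d - 1 - m) =
        σ u ^ (m : ℕ) / ((1 + σ u) ^ (x : ℕ) * (1 + σ u) ^ (d - 1 - x)) := by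
      rw [← e2, e3, div_pow, div_pow, one_pow]
      field_simp
    rw [e4, div_pow, pow_succ (1 + σ u) (d - 1 - x), pow_succ (1 + σ u) x]
    field_simp
  rw [e, hσ.contourIntegral_sum, Finset.sum_eq_single x]
  -- the term `k = x` has simple poles at `p / (1 - p)` and `-1`; the others have primitives
  · have e1 : contourIntegral σ (fun s => modeMatrix d p x m *
        ((p - s / (1 + s)) ^ ((x : ℤ) - (x + 1)) * (1 / (1 + s) ^ 2))) =
        contourIntegral σ (fun s => -modeMatrix d p x m * (1 / (s - p / (1 - p))) -
          -modeMatrix d p x m * (1 / (s - (-1)))) := by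
      refine contourIntegral_congr fun u hu => ?_
      have hs' := hs u hu
      have hp' := hpu u hu
      have ha' : σ u - p / (1 - p) = -(p - (1 - p) * σ u) / (1 - p) := by
        field_simp
        ring
      rw [show (x : ℤ) - (x + 1) = -1 by ring, zpow_neg_one, hv u hu, ha', sub_neg_eq_add,
        add_comm (σ u) 1]
      field_simp
      ring
    rw [e1, hσ.contourIntegral_sub, contourIntegral_const_mul_inv_sub h1.2,
      contourIntegral_const_mul_inv_sub h2.2]
    · ring
    · exact continuousOn_const.mul (continuousOn_const.div
        (hσ.continuousOn.sub continuousOn_const) ha)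
    · exact continuousOn_const.mul (continuousOn_const.div
        (hσ.continuousOn.sub continuousOn_const) fun u hu => sub_ne_zero.2 (h2.1 u hu))
  · intro k _ hk
    have hkx : ((k : ℂ) - x) ≠ 0 := sub_ne_zero.2 (by
      exact_mod_cast fun h => hk (Fin.ext h))
    rw [contourIntegral_const_mul, hσ.contourIntegral_eq_zero
      (F := fun s => -((p - s / (1 + s)) ^ ((k : ℤ) - x) / ((k : ℂ) - x))) (fun u hu => ?_) (hcz _),
      mul_zero]
    have h3 : HasDerivAt (fun s : ℂ => s / (1 + s)) (1 / (1 + σ u) ^ 2) (σ u) := by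
      have := (hasDerivAt_id (σ u)).div ((hasDerivAt_id (σ u)).const_add 1) (hs u hu)
      convert! this using 1
      simp
    have h4 := ((hasDerivAt_zpow ((k : ℤ) - x) (p - σ u / (1 + σ u)) (Or.inl (hv0 u hu))).comp
      (σ u) (h3.const_sub p)).div_const ((k : ℂ) - x) |>.neg
    convert! h4 using 1
    rw [show (k : ℤ) - (x + 1) = (k : ℤ) - x - 1 by ring]
    push_cast
    field_simp
  · simp
  · intro k _
    exact continuousOn_const.mul (hcz _)

/-- The double contour integral kernel is the space-time kernel of the binomial bases. -/
theorem busKernel_eq_spaceTimeKernel {n N : ℕ} {p q : ℝ} (hp : p < 1) {σ τ : ℝ → ℂ}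
    (h : AdmissibleContours p q σ τ) (x y : Fin (N + n)) :
    busKernel n N p q σ τ x y =
      (modeMatrix (N + n) (p : ℂ) * ((firstCoords ℂ n (N + n)).transpose *
        firstCoords ℂ n (N + n) - (if p < q then 1 else 0 : Matrix (Fin (N + n)) (Fin (N + n)) ℂ)) *
        siteMatrix (N + n) (q : ℂ)) x y := by
  have hp' : (1 : ℂ) - p ≠ 0 := by
    exact_mod_cast (sub_pos.2 hp).ne'
  set w : ℂ := if p < q then 1 else 0 with hw
  -- the position of the `s`-contour relative to the `t`-contour
  have hts : ∀ u ∈ Icc (0 : ℝ) 1, (∀ v ∈ Icc (0 : ℝ) 1, τ v ≠ σ u) ∧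
      windingNumber τ (σ u) = w := by
    intro u hu
    by_cases hpq : p < q
    · rw [hw, if_pos hpq]
      exact (h.t_contains_s hpq u hu).1
    · rw [hw, if_neg hpq]
      exact (h.s_contains_t (not_lt.1 hpq) u hu).2
  set c : ℂ := 2 * (Real.pi : ℂ) * Complex.I with hc
  have hc0 : c ≠ 0 := by simp [hc, Real.pi_ne_zero]
  -- the integral over `t`
  have inner : ∀ u ∈ Icc (0 : ℝ) 1, contourIntegral τ (fun t =>
      (((q : ℂ) - (1 - (q : ℂ)) * t) ^ (y : ℕ) * (1 + t) ^ (N + n - 1 - y) * t ^ (-(n : ℤ))) /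
        (((p : ℂ) - (1 - (p : ℂ)) * σ u) ^ ((x : ℕ) + 1) * (1 + σ u) ^ (N + n - x) *
          σ u ^ (-(n : ℤ))) * (1 / (t - σ u))) =
      ∑ m : Fin (N + n), c * siteMatrix (N + n) (q : ℂ) m y * (w - if (m : ℕ) < n then 1 else 0) *
        (σ u ^ (m : ℕ) / (((p : ℂ) - (1 - (p : ℂ)) * σ u) ^ ((x : ℕ) + 1) *
          (1 + σ u) ^ (N + n - x))) := by
    intro u hu
    set D := ((p : ℂ) - (1 - (p : ℂ)) * σ u) ^ ((x : ℕ) + 1) * (1 + σ u) ^ (N + n - x) with hD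
    have e1 : contourIntegral τ (fun t =>
        (((q : ℂ) - (1 - (q : ℂ)) * t) ^ (y : ℕ) * (1 + t) ^ (N + n - 1 - y) * t ^ (-(n : ℤ))) /
        (D * σ u ^ (-(n : ℤ))) * (1 / (t - σ u))) =
        contourIntegral τ (fun t => ∑ m : Fin (N + n),
          (D⁻¹ * siteMatrix (N + n) (q : ℂ) m y * σ u ^ n) *
            (t ^ (m : ℕ) * t ^ (-(n : ℤ)) * (1 / (t - σ u)))) := by
      refine contourIntegral_congr fun v _ => ?_
      -- for `σ u = 0`, `0⁻¹ = 0` makes dividing by `s ^ (-n)` the same as multiplying by `s ^ n`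
      rw [← sum_siteMatrix_mul_pow, zpow_neg (σ u), zpow_natCast, div_eq_mul_inv, mul_inv, inv_inv,
        Finset.sum_mul, Finset.sum_mul, Finset.sum_mul]
      refine Finset.sum_congr rfl fun m _ => ?_
      ring
    rw [e1, h.simple_t.contourIntegral_sum]
    · refine Finset.sum_congr rfl fun m _ => ?_
      rw [contourIntegral_const_mul, mul_assoc, h.simple_t.pow_mul_contourIntegral h.t_around
        (hts u hu).1 (hts u hu).2]
      rw [div_eq_mul_inv]
      ring
    · intro m _
      refine continuousOn_const.mul (((h.simple_t.continuousOn.pow _).mul ?_).mul ?_)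
      · exact h.simple_t.continuousOn.zpow₀ _ fun u hu => Or.inl (h.t_around.1 u hu)
      · exact continuousOn_const.div (h.simple_t.continuousOn.sub continuousOn_const)
          fun v hv => sub_ne_zero.2 ((hts u hu).1 v hv)
  rw [busKernel, contourIntegral_congr (g := fun s => ∑ m : Fin (N + n),
    c * siteMatrix (N + n) (q : ℂ) m y * (w - if (m : ℕ) < n then 1 else 0) *
        (s ^ (m : ℕ) / (((p : ℂ) - (1 - (p : ℂ)) * s) ^ ((x : ℕ) + 1) *
          (1 + s) ^ (N + n - x)))) inner, h.simple_s.contourIntegral_sum]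
  · have e2 : modeMatrix (N + n) (p : ℂ) * ((firstCoords ℂ n (N + n)).transpose *
        firstCoords ℂ n (N + n) - (if p < q then 1 else 0 : Matrix (Fin (N + n)) (Fin (N + n)) ℂ)) =
        modeMatrix (N + n) (p : ℂ) * Matrix.diagonal fun m : Fin (N + n) =>
          (if (m : ℕ) < n then 1 else 0) - w := by
      rw [transpose_mul_firstCoords]
      congr 1
      ext i j
      by_cases hij : i = j <;> by_cases hpq : p < q <;> simp [hij, hpq, hw]
    rw [e2, Matrix.mul_apply, Finset.mul_sum]
    refine Finset.sum_congr rfl fun m _ => ?_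
    rw [contourIntegral_const_mul, h.simple_s.contourIntegral_eq_modeMatrix hp'
      (by simpa using h.s_around) h.s_avoids, Matrix.mul_diagonal]
    field_simp
    ring
  · intro m _
    refine continuousOn_const.mul (ContinuousOn.div (h.simple_s.continuousOn.pow _)
      (((continuousOn_const.sub (continuousOn_const.mul h.simple_s.continuousOn)).pow _).mul
        ((continuousOn_const.add h.simple_s.continuousOn).pow _)) fun u hu => ?_)
    refine mul_ne_zero (pow_ne_zero _ fun e => h.s_around.1 u hu ?_)
      (pow_ne_zero _ fun e => h.s_avoids.1 u hu (by linear_combination e))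
    rw [eq_div_iff hp']
    linear_combination -e

/-- The circle of centre `c` and radius `R`, parametrised by `[0, 1]`. -/
noncomputable def circleContour (c : ℂ) (R : ℝ) (u : ℝ) : ℂ := circleMap c R (2 * Real.pi * u)

lemma hasDerivAt_circleContour (c : ℂ) (R u : ℝ) :
    HasDerivAt (circleContour c R)
      ((2 * Real.pi : ℝ) • deriv (circleMap c R) (2 * Real.pi * u)) u := by
  have h1 : HasDerivAt (fun u : ℝ => 2 * Real.pi * u) (2 * Real.pi) u := by
    simpa using (hasDerivAt_id u).const_mul (2 * Real.pi)
  have h2 := (differentiable_circleMap c R (2 * Real.pi * u)).hasDerivAt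
  exact h2.scomp u h1

lemma contourIntegral_circleContour (c : ℂ) (R : ℝ) (f : ℂ → ℂ) :
    contourIntegral (circleContour c R) f = circleIntegral f c R := by
  have h := intervalIntegral.smul_integral_comp_mul_left (a := 0) (b := 1)
    (fun θ => deriv (circleMap c R) θ • f (circleMap c R θ)) (2 * Real.pi)
  rw [mul_zero, mul_one] at h
  rw [circleIntegral, ← h, ← intervalIntegral.integral_smul, contourIntegral]
  refine intervalIntegral.integral_congr fun u _ => ?_
  simp only [(hasDerivAt_circleContour c R u).deriv, smul_eq_mul, Complex.real_smul]
  rw [circleContour]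
  ring

lemma norm_circleContour_sub (c : ℂ) {R : ℝ} (hR : 0 < R) (u : ℝ) :
    ‖circleContour c R u - c‖ = R := by
  simp [circleContour, abs_of_pos hR]

lemma isSimpleContour_circleContour (c : ℂ) {R : ℝ} (hR : 0 < R) :
    IsSimpleContour (circleContour c R) where
  continuousOn := fun u _ =>
    (hasDerivAt_circleContour c R u).continuousAt.continuousWithinAt
  closed := by simp [circleContour, circleMap]
  simple := by
    intro u hu v hv huv
    have hpi := Real.two_pi_pos
    have := injOn_circleMap_of_abs_sub_le' hR.ne' (a := 0) (b := 2 * Real.pi) (c := c) (by simp)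
      (show 2 * Real.pi * u ∈ Ico 0 (2 * Real.pi) from
        ⟨mul_nonneg hpi.le hu.1, by nlinarith [hu.2]⟩)
      (show 2 * Real.pi * v ∈ Ico 0 (2 * Real.pi) from
        ⟨mul_nonneg hpi.le hv.1, by nlinarith [hv.2]⟩) huv
    exact mul_left_cancel₀ hpi.ne' this
  piecewise := by
    have hd : deriv (circleContour c R) = fun u =>
        (2 * Real.pi : ℝ) • deriv (circleMap c R) (2 * Real.pi * u) :=
      funext fun u => (hasDerivAt_circleContour c R u).deriv
    refine ⟨∅, fun u _ => (hasDerivAt_circleContour c R u).differentiableAt, ?_,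
      2 * Real.pi * R, fun u _ => ?_⟩
    · rw [hd]
      simp only [deriv_circleMap]
      have := continuous_circleMap 0 R
      fun_prop
    · rw [hd]
      simp [abs_of_pos hR, abs_of_pos Real.pi_pos]

lemma goesAround_circleContour {c w : ℂ} {R : ℝ} (h : ‖w - c‖ < R) :
    GoesAround (circleContour c R) w := by
  have hR : 0 < R := (norm_nonneg _).trans_lt h
  refine ⟨fun u _ e => ?_, ?_⟩
  · rw [← e, norm_circleContour_sub c hR] at h
    exact lt_irrefl _ h
  · rw [windingNumber, contourIntegral_circleContour]
    have := circleIntegral.integral_sub_inv_of_mem_ball (c := c) (w := w) (R := R)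
      (by rwa [Metric.mem_ball, dist_eq_norm])
    simp only [one_div, this]
    exact inv_mul_cancel₀ (by simp [Real.pi_ne_zero])

lemma liesOutside_circleContour {c w : ℂ} {R : ℝ} (hR : 0 < R) (h : R < ‖w - c‖) :
    LiesOutside (circleContour c R) w := by
  have hne : ∀ z ∈ Metric.closedBall c R, z - w ≠ 0 := fun z hz e => by
    rw [sub_eq_zero.1 e, Metric.mem_closedBall, dist_eq_norm] at hz
    exact hz.not_gt h
  refine ⟨fun u _ => sub_ne_zero.1 (hne _ ?_), ?_⟩
  · rw [Metric.mem_closedBall, dist_eq_norm, norm_circleContour_sub c hR]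
  · rw [windingNumber, contourIntegral_circleContour,
      Complex.circleIntegral_eq_zero_of_differentiable_on_off_countable hR.le countable_empty,
      mul_zero]
    · exact continuousOn_const.div (continuousOn_id.sub continuousOn_const) hne
    · intro z hz
      exact (differentiableAt_const _).div (differentiableAt_id.sub_const _)
        (hne z (Metric.ball_subset_closedBall hz.1))

theorem exists_admissibleContours {p q : ℝ} (hp0 : 0 < p) (hp1 : p < 1) :
    ∃ σ τ : ℝ → ℂ, AdmissibleContours p q σ τ := by
  set a : ℝ := p / (1 - p) with ha
  have ha0 : 0 < a := div_pos hp0 (sub_pos.2 hp1)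
  have hac : (p : ℂ) / (1 - (p : ℂ)) = (a : ℂ) := by rw [ha]; push_cast; rfl
  have hn : ‖(a : ℂ)‖ = a := by simp [abs_of_pos ha0]
  have h1 : ‖(-1 : ℂ) - a‖ = 1 + a := by
    rw [show (-1 : ℂ) - a = -((1 + a : ℝ) : ℂ) by push_cast; ring, norm_neg, Complex.norm_real,
      Real.norm_of_nonneg (by positivity)]
  by_cases hpq : p < q
  -- a small circle about `a`, inside a circle about `0`
  · have hσ := norm_circleContour_sub (a : ℂ) (R := 1 / 2) (by norm_num)
    have hτ := norm_circleContour_sub (0 : ℂ) (R := 1 + a) (by positivity)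
    refine ⟨circleContour a (1 / 2), circleContour 0 (1 + a),
      isSimpleContour_circleContour _ (by norm_num),
      isSimpleContour_circleContour _ (by positivity),
      hac ▸ goesAround_circleContour (by simp), liesOutside_circleContour (by norm_num)
        (by rw [h1]; linarith), goesAround_circleContour (by simp; positivity),
      fun h => absurd hpq (not_lt.2 h), fun _ u _ => ⟨goesAround_circleContour ?_,
        liesOutside_circleContour (by norm_num) ?_⟩⟩
    · have := norm_add_le (circleContour a (1 / 2) u - a) a
      rw [sub_add_cancel, hσ, hn] at this
      rw [sub_zero]
      linarith
    · have := norm_sub_norm_le (circleContour 0 (1 + a) u) a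
      have h2 := hτ u
      rw [sub_zero] at h2
      rw [h2, hn] at this
      linarith
  -- a circle about `a` enclosing `0` but not `-1`, and a small circle about `0`
  · have hσ := norm_circleContour_sub (a : ℂ) (R := a + 1 / 2) (by positivity)
    have hτ := norm_circleContour_sub (0 : ℂ) (R := 1 / 4) (by norm_num)
    refine ⟨circleContour a (a + 1 / 2), circleContour 0 (1 / 4),
      isSimpleContour_circleContour _ (by positivity),
      isSimpleContour_circleContour _ (by norm_num),
      hac ▸ goesAround_circleContour (by simp; positivity),
      liesOutside_circleContour (by positivity) (by rw [h1]; linarith),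
      goesAround_circleContour (by simp),
      fun _ u _ => ⟨goesAround_circleContour ?_, liesOutside_circleContour (by norm_num) ?_⟩,
      fun h => absurd h hpq⟩
    · have := norm_sub_le (circleContour 0 (1 / 4) u) a
      have h2 := hτ u
      rw [sub_zero] at h2
      rw [h2, hn] at this
      linarith
    · have := norm_sub_norm_le (circleContour a (a + 1 / 2) u - a) (-a)
      rw [sub_neg_eq_add, sub_add_cancel, hσ, norm_neg, hn] at this
      rw [sub_zero]
      linarith

end Contours

/-! ### Independence of the past and the increments -/

section Past

variable {Ω : Type*} {n : ℕ}

/-- The information carried by all buses up to time `t`. -/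
@[reducible] def pastAlgebra (X : Fin n → ℝ≥0 → Ω → ℕ) (t : ℝ≥0) : MeasurableSpace Ω :=
  MeasurableSpace.comap (fun ω (i : Fin n) (s : Iic t) => X i s ω) inferInstance

variable {X : Fin n → ℝ≥0 → Ω → ℕ}

lemma measurable_pastAlgebra {s t : ℝ≥0} (hst : s ≤ t) (i : Fin n) :
    Measurable[pastAlgebra X t] (X i s) := by
  have h : Measurable[pastAlgebra X t] (fun ω (i : Fin n) (s : Iic t) => X i s ω) :=
    comap_measurable _
  exact (measurable_pi_apply (⟨s, hst⟩ : Iic t)).comp ((measurable_pi_apply i).comp h)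

lemma pastAlgebra_mono {s t : ℝ≥0} (hst : s ≤ t) : pastAlgebra X s ≤ pastAlgebra X t := by
  have h : Measurable[pastAlgebra X t] fun ω (i : Fin n) (r : Iic s) => X i r ω := by
    let _ := pastAlgebra X t
    exact measurable_pi_lambda _ fun i => measurable_pi_lambda _ fun r =>
      measurable_pastAlgebra (r.2.trans hst) i
  exact h.comap_le

end Past

section Independence

variable {Ω : Type*} [MeasurableSpace Ω] {P : Measure Ω}

/-- If the pairs `(f i, g i)` are independent of each other and each `f i` is independent of `g i`,
then the family `f` is independent of the family `g`. -/
lemma indepFun_pi_of_iIndepFun_prodMk [IsProbabilityMeasure P] {ι : Type*} [Fintype ι]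
    {α β : ι → Type*} [∀ i, MeasurableSpace (α i)] [∀ i, MeasurableSpace (β i)]
    {f : ∀ i, Ω → α i} {g : ∀ i, Ω → β i} (hf : ∀ i, Measurable (f i)) (hg : ∀ i, Measurable (g i))
    (h : iIndepFun (fun i ω => (f i ω, g i ω)) P) (hfg : ∀ i, IndepFun (f i) (g i) P) :
    IndepFun (fun ω i => f i ω) (fun ω i => g i ω) P := by
  refine IndepSets.indep (measurable_pi_lambda _ hf).comap_le (measurable_pi_lambda _ hg).comap_le
    (isPiSystem_pi.comap (fun ω i => f i ω)) (isPiSystem_pi.comap (fun ω i => g i ω))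
    (by rw [← generateFrom_pi, MeasurableSpace.comap_generateFrom]; rfl)
    (by rw [← generateFrom_pi, MeasurableSpace.comap_generateFrom]; rfl) ?_
  rw [IndepSets_iff]
  rintro _ _ ⟨_, ⟨U, hU, rfl⟩, rfl⟩ ⟨_, ⟨W, hW, rfl⟩, rfl⟩
  have hU' : ∀ i, MeasurableSet (U i) := fun i => hU i (mem_univ i)
  have hW' : ∀ i, MeasurableSet (W i) := fun i => hW i (mem_univ i)
  have e1 := h.measure_inter_preimage_eq_mul Finset.univ (sets := fun i => U i ×ˢ W i)
    fun i _ => (hU' i).prod (hW' i)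
  have e2 := h.measure_inter_preimage_eq_mul Finset.univ (sets := fun i => U i ×ˢ univ)
    fun i _ => (hU' i).prod MeasurableSet.univ
  have e3 := h.measure_inter_preimage_eq_mul Finset.univ (sets := fun i => univ ×ˢ W i)
    fun i _ => MeasurableSet.univ.prod (hW' i)
  have e4 : ∀ i, P ((fun ω => (f i ω, g i ω)) ⁻¹' U i ×ˢ W i) =
      P ((fun ω => (f i ω, g i ω)) ⁻¹' U i ×ˢ univ) *
        P ((fun ω => (f i ω, g i ω)) ⁻¹' univ ×ˢ W i) := by
    intro i
    have := (hfg i).measure_inter_preimage_eq_mul (U i) (W i) (hU' i) (hW' i)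
    convert! this using 2
    · congr 1; ext ω; simp
    · congr 1; ext ω; simp
  simp_rw [e4, Finset.prod_mul_distrib, ← e2, ← e3] at e1
  convert! e1 using 2
  · ext ω
    simp [Set.mem_pi, forall_and]
  · congr 1; ext ω; simp [Set.mem_pi]
  · congr 1; ext ω; simp [Set.mem_pi]

/-- The past of a Poisson process up to time `t` is independent of its increments after `t`. -/
lemma IsPoissonProcess.indepFun_past [IsProbabilityMeasure P] {X : ℝ≥0 → Ω → ℕ} {r : ℝ≥0}
    (hX : IsPoissonProcess X r P) {t t' : ℝ≥0} (htt' : t ≤ t') :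
    IndepFun (fun ω (s : Iic t) => X s ω) (fun ω => X t' ω - X t ω) P := by
  refine IndepFun.process_indepFun (fun s => hX.measurable s)
    ((hX.measurable t').sub (hX.measurable t)) fun I => ?_
  set k := I.card with hk
  set o := I.orderEmbOfFin hk.symm with ho
  -- the times `0`, the elements of `I` in increasing order, `t`, `t'`
  set τ : ℕ → ℝ≥0 := fun j => if j = 0 then 0 else
    if h : j - 1 < k then (o ⟨j - 1, h⟩ : ℝ≥0) else if j = k + 1 then t else t' with hτ
  have hmono : Monotone τ := by
    refine monotone_nat_of_le_succ fun j => ?_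
    rcases Nat.eq_zero_or_pos j with rfl | hj
    · simp [hτ]
    · simp only [hτ, hj.ne', if_false, Nat.add_sub_cancel, Nat.succ_ne_zero]
      split_ifs
      all_goals first
        | omega
        | exact o.monotone (by simp [Fin.le_def])
        | exact (o _).2
        | exact htt'
        | exact le_rfl
  have hind := hX.indep_increments.nat hmono
  have hinc : ∀ j : ℕ, Measurable fun ω => X (τ (j + 1)) ω - X (τ j) ω := fun j =>
    (hX.measurable _).sub (hX.measurable _)
  have h := hind.indepFun_finset (Finset.range (k + 1)) {k + 1} (by simp) hinc
  have hτ1 : τ (k + 1) = t := by simp [hτ]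
  have hτ2 : τ (k + 1 + 1) = t' := by simp [hτ]
  have hsum : ∀ (j : ℕ) ω, X (τ j) ω =
      ∑ l ∈ Finset.range j, (X (τ (l + 1)) ω - X (τ l) ω) := by
    intro j ω
    rw [Finset.sum_range_tsub (f := fun j => X (τ j) ω) ((hX.monotone ω).comp hmono)]
    simp [hτ, hX.start_zero]
  have hidx : ∀ s : I, ∃ j : ℕ, j < k + 1 ∧ τ j = (s : Iic t) := by
    intro s
    have : (s : Iic t) ∈ Set.range o := by
      rw [ho, Finset.range_orderEmbOfFin]
      exact s.2
    obtain ⟨j, hj⟩ := this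
    exact ⟨j + 1, by omega, by simp [hτ, hj]⟩
  choose idx hidx1 hidx2 using hidx
  have hφ : Measurable fun (v : Finset.range (k + 1) → ℕ) (s : I) =>
      ∑ l : Finset.range (k + 1), if (l : ℕ) < idx s then v l else 0 :=
    measurable_pi_lambda _ fun s => Finset.measurable_sum _ fun l _ => by
      split_ifs
      · exact measurable_pi_apply _
      · exact measurable_const
  have hψ : Measurable fun (v : ({k + 1} : Finset ℕ) → ℕ) => v ⟨k + 1, by simp⟩ :=
    measurable_pi_apply _
  have h' := h.comp hφ hψ
  convert! h' using 1
  · ext ω s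
    simp only [Function.comp]
    rw [← hidx2 s, hsum,
      Finset.sum_coe_sort (Finset.range (k + 1))
        (fun l => if l < idx s then X (τ (l + 1)) ω - X (τ l) ω else 0), ← Finset.sum_filter]
    congr 1
    ext l
    have := hidx1 s
    simp
    omega
  · ext ω
    simp only [Function.comp, hτ1, hτ2]

variable {n : ℕ} {X : Fin n → ℝ≥0 → Ω → ℕ}

lemma pastAlgebra_le (hX : ∀ i t, Measurable (X i t)) (t : ℝ≥0) :
    pastAlgebra X t ≤ ‹MeasurableSpace Ω› :=
  (measurable_pi_lambda _ fun i => measurable_pi_lambda _ fun _ => hX i _).comap_le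

/-- The joint law of the increments over `[t, t']`, given an event of the past. -/
lemma measureReal_inter_increments [IsProbabilityMeasure P]
    (hX : ∀ i, IsPoissonProcess (X i) 1 P) (hX_indep : iIndepFun (fun i ω s => X i s ω) P)
    {t t' : ℝ≥0} (htt' : t ≤ t') {F : Set Ω} (hF : MeasurableSet[pastAlgebra X t] F)
    (ξ : Fin n → ℕ) :
    P.real (F ∩ {ω | ∀ i, X i t' ω - X i t ω = ξ i}) =
      P.real F * ∏ i, (Real.exp (-((t' - t : ℝ≥0) : ℝ)) * ((t' - t : ℝ≥0) : ℝ) ^ ξ i / (ξ i)!) := by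
  have hm : ∀ i, Measurable fun ω => X i t' ω - X i t ω := fun i =>
    ((hX i).measurable t').sub ((hX i).measurable t)
  have hpair : iIndepFun (fun i ω => ((fun s : Iic t => X i s ω), X i t' ω - X i t ω)) P := by
    refine hX_indep.comp (fun i (v : ℝ≥0 → ℕ) => ((fun s : Iic t => v s), v t' - v t)) fun i => ?_
    exact (measurable_pi_lambda _ fun s => measurable_pi_apply _).prodMk
      ((measurable_pi_apply _).sub (measurable_pi_apply _))
  have hind := indepFun_pi_of_iIndepFun_prodMk
    (fun i => measurable_pi_lambda _ fun s : Iic t => (hX i).measurable s) hm hpair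
    fun i => (hX i).indepFun_past htt'
  have hinc : iIndepFun (fun i ω => X i t' ω - X i t ω) P :=
    hX_indep.comp (fun i (v : ℝ≥0 → ℕ) => v t' - v t) fun i =>
      (measurable_pi_apply _).sub (measurable_pi_apply _)
  obtain ⟨U, hU, rfl⟩ := hF
  have e1 := hind.measure_inter_preimage_eq_mul U {ξ} hU (measurableSet_singleton _)
  have e2 := hinc.measure_inter_preimage_eq_mul Finset.univ (sets := fun i => {ξ i})
    fun i _ => measurableSet_singleton _
  have e3 : (fun ω i => X i t' ω - X i t ω) ⁻¹' {ξ} = {ω | ∀ i, X i t' ω - X i t ω = ξ i} := by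
    ext ω
    simp [funext_iff]
  have e4 : (⋂ i ∈ Finset.univ, (fun ω => X i t' ω - X i t ω) ⁻¹' {ξ i}) =
      {ω | ∀ i, X i t' ω - X i t ω = ξ i} := by
    ext ω
    simp
  rw [e3] at e1
  rw [e4] at e2
  rw [measureReal_def, e1, e2, ENNReal.toReal_mul, ENNReal.toReal_prod, measureReal_def]
  congr 1
  refine Finset.prod_congr rfl fun i _ => ?_
  have hl := (hX i).increment_law t t' htt'
  rw [← Measure.map_apply (hm i) (measurableSet_singleton _), hl.map_eq, ← measureReal_def,
    poissonMeasure_real_singleton, one_mul]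

end Independence

/-! ### The forward equation and its determinantal solution -/

section ForwardEquation

variable {n : ℕ}

/-- `expTerm k t = t ^ k / k!`, extended by `0` to negative `k`. -/
noncomputable def expTerm (k : ℤ) (t : ℝ) : ℝ := if 0 ≤ k then t ^ k.toNat / (k.toNat)! else 0

/-- `det (expTerm (y j - a i) t)`: up to the factor `exp (-n t)`, the probability that independent
rate one Poisson walks from `a` arrive at `y` at time `t` without meeting. -/
noncomputable def transDet (a y : Fin n → ℤ) (t : ℝ) : ℝ :=
  (Matrix.of fun i j => expTerm (y j - a i) t).det

lemma expTerm_of_neg {k : ℤ} (hk : k < 0) (t : ℝ) : expTerm k t = 0 := if_neg (not_le.2 hk)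

lemma expTerm_zero_right (k : ℤ) : expTerm k 0 = if k = 0 then 1 else 0 := by
  rcases lt_trichotomy k 0 with h | rfl | h
  · rw [expTerm_of_neg h, if_neg h.ne]
  · simp [expTerm]
  · have : k.toNat ≠ 0 := by omega
    simp [expTerm, h.ne', this]

lemma hasDerivAt_expTerm (k : ℤ) (t : ℝ) : HasDerivAt (expTerm k) (expTerm (k - 1) t) t := by
  rcases lt_trichotomy k 0 with h | rfl | h
  · rw [expTerm_of_neg (by omega)]
    exact (hasDerivAt_const t (0 : ℝ)).congr_of_eventuallyEq
      (Filter.Eventually.of_forall fun s => expTerm_of_neg h s)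
  · rw [expTerm_of_neg (by omega)]
    exact (hasDerivAt_const t (1 : ℝ)).congr_of_eventuallyEq
      (Filter.Eventually.of_forall fun s => by simp [expTerm])
  · obtain ⟨m, rfl⟩ : ∃ m : ℕ, k = m + 1 := ⟨(k - 1).toNat, by omega⟩
    have h1 : ∀ s, expTerm ((m : ℤ) + 1) s = s ^ (m + 1) / ((m + 1)! : ℝ) := fun s => by
      rw [expTerm, if_pos (by omega)]
      norm_cast
    have h2 : expTerm ((m : ℤ) + 1 - 1) t = t ^ m / (m ! : ℝ) := by
      rw [expTerm, if_pos (by omega)]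
      simp
    rw [h2, funext h1]
    have := (hasDerivAt_pow (m + 1) t).div_const ((m + 1)! : ℝ)
    convert! this using 1
    rw [Nat.factorial_succ]
    push_cast
    field_simp

lemma hasDerivAt_transDet (a y : Fin n → ℤ) (t : ℝ) :
    HasDerivAt (transDet a y) (∑ i, transDet a (y - Pi.single i 1) t) t := by
  have h1 : ∀ y, transDet a y = fun t =>
      ∑ σ : Equiv.Perm (Fin n), ((Equiv.Perm.sign σ : ℤ) : ℝ) *
        ∏ j, expTerm (y j - a (σ j)) t := fun y => by
    ext t
    rw [transDet, Matrix.det_apply']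
    rfl
  have h2 : HasDerivAt (transDet a y) (∑ σ : Equiv.Perm (Fin n), ((Equiv.Perm.sign σ : ℤ) : ℝ) *
      ∑ i, (∏ j ∈ Finset.univ.erase i, expTerm (y j - a (σ j)) t) •
        expTerm (y i - a (σ i) - 1) t) t := by
    rw [h1]
    refine HasDerivAt.fun_sum fun σ _ => HasDerivAt.const_mul _ ?_
    exact HasDerivAt.fun_finsetProd fun i _ => hasDerivAt_expTerm _ _
  convert! h2 using 1
  simp only [h1]
  rw [Finset.sum_comm]
  refine Finset.sum_congr rfl fun σ _ => ?_
  rw [← Finset.mul_sum]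
  congr 1
  refine Finset.sum_congr rfl fun i _ => ?_
  rw [← Finset.prod_erase_mul _ _ (Finset.mem_univ i), smul_eq_mul]
  congr 1
  · refine Finset.prod_congr rfl fun j hj => ?_
    have : j ≠ i := Finset.ne_of_mem_erase hj
    simp [this]
  · congr 1
    simp
    ring

lemma transDet_zero {a y : Fin n → ℤ} (ha : StrictAnti a) (hy : StrictAnti y) :
    transDet a y 0 = if y = a then 1 else 0 := by
  have e : transDet a y 0 = (Matrix.of fun i j => if y j = a i then (1 : ℝ) else 0).det := by
    rw [transDet]
    congr 1
    ext i j
    simp [expTerm_zero_right, sub_eq_zero]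
  rw [e]
  split_ifs with h
  · subst h
    rw [← Matrix.det_one (n := Fin n) (R := ℝ)]
    congr 1
    ext i j
    simp [Matrix.one_apply, hy.injective.eq_iff, eq_comm]
  · -- some `y j` is not among the `a i`, so its column vanishes
    obtain ⟨j, hj⟩ : ∃ j, ∀ i, y j ≠ a i := by
      by_contra! hcon
      choose f hf using hcon
      refine h (funext fun j => ?_)
      have hmono : StrictMono f := fun i j hij => by
        have := hy hij
        rw [hf i, hf j] at this
        exact ha.lt_iff_gt.1 this
      have : f = id := hmono.range_inj strictMono_id |>.1 (by
        rw [Set.range_id, (Finite.injective_iff_surjective.1 hmono.injective).range_eq])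
      rw [hf j, this, id]
    exact Matrix.det_eq_zero_of_column_eq_zero j fun i => if_neg (hj i)

lemma transDet_eq_zero_of_neg {a y : Fin n → ℤ} (ha : ∀ i, 0 ≤ a i) {j : Fin n} (hj : y j < 0)
    (t : ℝ) : transDet a y t = 0 :=
  Matrix.det_eq_zero_of_column_eq_zero j fun i => expTerm_of_neg (by have := ha i; omega) t

/-- Moving one particle back by one step out of the chamber makes two coordinates coincide. -/
lemma transDet_sub_single_eq_zero {a y : Fin n → ℤ} (hy : StrictAnti y) {i : Fin n}
    (h : ¬ StrictAnti (y - Pi.single i 1)) (t : ℝ) : transDet a (y - Pi.single i 1) t = 0 := by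
  simp only [StrictAnti, not_forall, not_lt] at h
  obtain ⟨j, k, hjk, hle⟩ := h
  have hlt := hy hjk
  have hj : j = i := by
    by_contra hj
    rw [Pi.sub_apply, Pi.sub_apply, Pi.single_eq_of_ne hj] at hle
    have : (0 : ℤ) ≤ (Pi.single i 1 : Fin n → ℤ) k := by
      by_cases hk : k = i
      · subst hk; simp
      · simp [hk]
    omega
  subst hj
  refine Matrix.det_zero_of_column_eq hjk.ne fun i => ?_
  have hk : (Pi.single j 1 : Fin n → ℤ) k = 0 := Pi.single_eq_of_ne hjk.ne' _
  simp only [Pi.sub_apply, Pi.single_eq_same, hk, sub_zero] at hle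
  simp only [Matrix.of_apply, Pi.sub_apply, Pi.single_eq_same, hk]
  congr 2
  omega

/-- A function that satisfies the one-step estimate of a Poisson system is right differentiable. -/
lemma hasDerivWithinAt_of_step {ν : ℝ} (f : ℝ → ℝ) (t A B : ℝ) (hA : f t = A)
    (h : ∀ s, 0 ≤ s → |f (t + s) - Real.exp (-(ν * s)) * (A + s * B)| ≤
      1 - Real.exp (-(ν * s)) * (1 + ν * s)) :
    HasDerivWithinAt f (B - ν * A) (Ici t) t := by
  have hexp : HasDerivAt (fun s : ℝ => Real.exp (-(ν * (s - t)))) (-ν) t := by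
    have h1 : HasDerivAt (fun s : ℝ => -(ν * (s - t))) (-ν) t := by
      simpa using (((hasDerivAt_id t).sub_const t).const_mul ν).fun_neg
    have := h1.exp
    simpa using this
  have hlin : ∀ a b : ℝ, HasDerivAt (fun s : ℝ => a + (s - t) * b) b t := fun a b => by
    simpa using (((hasDerivAt_id t).sub_const t).mul_const b).const_add a
  -- `f` agrees with the smooth function of `hφ` up to the error `hψ`, of derivative `0` at `t`
  have hφ : HasDerivAt (fun s : ℝ => Real.exp (-(ν * (s - t))) * (A + (s - t) * B))
      (B - ν * A) t := by
    have := hexp.mul (hlin A B)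
    convert! this using 1
    simp
    ring
  have hψ : HasDerivAt (fun s : ℝ => 1 - Real.exp (-(ν * (s - t))) * (1 + (s - t) * ν)) 0 t := by
    have := (hexp.mul (hlin 1 ν)).const_sub 1
    convert! this using 1
    simp
  have hd : HasDerivWithinAt (fun s => f s - Real.exp (-(ν * (s - t))) * (A + (s - t) * B)) 0
      (Ici t) t := by
    rw [hasDerivWithinAt_iff_isLittleO]
    have h2 := (hasDerivWithinAt_iff_isLittleO.1 (hψ.hasDerivWithinAt (s := Ici t)))
    refine Asymptotics.IsBigO.trans_isLittleO (Asymptotics.IsBigO.of_bound 1 ?_) h2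
    filter_upwards [self_mem_nhdsWithin] with s hs
    have := h (s - t) (sub_nonneg.2 hs)
    rw [add_sub_cancel, mul_comm ν (s - t)] at this
    simp only [sub_self, mul_zero, neg_zero, Real.exp_zero, zero_mul, add_zero, mul_one, one_mul,
      smul_zero, sub_zero, hA, Real.norm_eq_abs]
    rw [mul_comm ν (s - t)]
    exact this.trans (le_abs_self _)
  have := hd.fun_add hφ.hasDerivWithinAt
  simpa using this

/-- Uniqueness for the forward equation of the killed Poisson system: the equation is triangular in
the sum of the coordinates, and the determinant solves it because it vanishes on the walls. -/
theorem eq_transDet_of_step {a : Fin n → ℤ} (ha : StrictAnti a) (ha0 : ∀ i, 0 ≤ a i) {c : ℝ}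
    (u : (Fin n → ℤ) → ℝ → ℝ) (hu0 : ∀ y t, 0 ≤ u y t) (hu1 : ∀ y t, u y t ≤ 1)
    (hwall : ∀ y t, ¬ StrictAnti y → u y t = 0) (hneg : ∀ y t i, y i < 0 → u y t = 0)
    (hinit : ∀ y, u y 0 = if y = a then c else 0)
    (hstep : ∀ y, StrictAnti y → ∀ t, 0 ≤ t → ∀ s, 0 ≤ s →
      |u y (t + s) - Real.exp (-(n * s)) * (u y t + s * ∑ i, u (y - Pi.single i 1) t)| ≤
        1 - Real.exp (-(n * s)) * (1 + n * s))
    {y : Fin n → ℤ} (hy : StrictAnti y) {t : ℝ} (ht : 0 ≤ t) :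
    u y t = c * Real.exp (-(n * t)) * transDet a y t := by
  -- continuity
  have hcont : ∀ y, StrictAnti y → ContinuousOn (u y) (Ici 0) := by
    intro y hy
    have key : ∀ t, 0 ≤ t → ∀ s, 0 ≤ s → |u y (t + s) - u y t| ≤ 3 * n * s := by
      intro t ht s hs
      have h1 := hstep y hy t ht s hs
      have hns : (0 : ℝ) ≤ n * s := by positivity
      have hB0 : 0 ≤ ∑ i, u (y - Pi.single i 1) t := Finset.sum_nonneg fun i _ => hu0 _ _
      have hB1 : ∑ i, u (y - Pi.single i 1) t ≤ n := by
        refine (Finset.sum_le_sum fun i _ => hu1 _ _).trans ?_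
        simp
      have he0 := Real.exp_pos (-(n * s))
      have he1 : Real.exp (-(n * s)) ≤ 1 := Real.exp_le_one_iff.2 (by linarith)
      have he2 := Real.one_sub_le_exp_neg (n * s)
      set B := ∑ i, u (y - Pi.single i 1) t
      set E := Real.exp (-(n * s))
      have hA0 := hu0 y t
      have hA1 := hu1 y t
      have h2 : 0 ≤ s * B := mul_nonneg hs hB0
      have h3 : s * B ≤ n * s := by rw [mul_comm (n : ℝ)]; exact mul_le_mul_of_nonneg_left hB1 hs
      have h4 : E * (s * B) ≤ s * B := mul_le_of_le_one_left h2 he1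
      have h5 : 0 ≤ E * (s * B) := mul_nonneg he0.le h2
      have h6 : (1 - E) * u y t ≤ 1 - E := mul_le_of_le_one_right (by linarith) hA1
      have h7 : 0 ≤ (1 - E) * u y t := mul_nonneg (by linarith) hA0
      have h8 : 0 ≤ E * (n * s) := mul_nonneg he0.le hns
      rw [abs_le] at h1 ⊢
      constructor <;> nlinarith [h1.1, h1.2]
    have : LipschitzOnWith (3 * n : ℝ≥0) (u y) (Ici 0) := by
      refine LipschitzOnWith.of_dist_le_mul fun s hs t ht => ?_
      rw [Real.dist_eq, Real.dist_eq]
      push_cast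
      rcases le_total s t with h | h
      · have := key s hs (t - s) (by linarith)
        rw [add_sub_cancel] at this
        rw [abs_sub_comm, abs_sub_comm s t, abs_of_nonneg (sub_nonneg.2 h)]
        exact this
      · have := key t ht (s - t) (by linarith)
        rw [add_sub_cancel] at this
        rw [abs_of_nonneg (sub_nonneg.2 h)]
        exact this
    exact this.continuousOn
  -- induction on the sum of the coordinates
  have main : ∀ k : ℕ, ∀ y : Fin n → ℤ, StrictAnti y → ∑ i, y i < k → ∀ t, 0 ≤ t →
      Real.exp (n * t) * u y t = c * transDet a y t := by
    intro k
    induction k with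
    | zero =>
      intro y hy hsum t ht
      obtain ⟨i, -, hi⟩ : ∃ i ∈ Finset.univ, y i < 0 := by
        by_contra! hcon
        exact absurd (Finset.sum_nonneg hcon) (not_le.2 (by simpa using hsum))
      rw [hneg y t i hi, transDet_eq_zero_of_neg ha0 hi, mul_zero, mul_zero]
    | succ k ih =>
      intro y hy hsum t ht
      have hexp : ∀ t : ℝ, HasDerivAt (fun t : ℝ => Real.exp (n * t)) (n * Real.exp (n * t)) t := by
        intro t
        have h1 : HasDerivAt (fun t : ℝ => (n : ℝ) * t) n t := by
          simpa using (hasDerivAt_id t).const_mul (n : ℝ)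
        simpa [mul_comm] using h1.exp
      refine eq_of_has_deriv_right_eq (a := 0) (b := t)
        (f := fun t => Real.exp (n * t) * u y t) (g := fun t => c * transDet a y t)
        (f' := fun t => c * ∑ i, transDet a (y - Pi.single i 1) t) ?_ ?_ ?_ ?_ ?_ t ⟨ht, le_rfl⟩
      · intro s hs
        have h1 := hasDerivWithinAt_of_step (u y) s _ _ rfl fun r hr => hstep y hy s hs.1 r hr
        have h2 := ((hexp s).hasDerivWithinAt (s := Ici s)).mul h1
        convert! h2 using 1
        have h3 : ∀ i, c * transDet a (y - Pi.single i 1) s =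
            Real.exp (n * s) * u (y - Pi.single i 1) s := by
          intro i
          by_cases hi : StrictAnti (y - Pi.single i 1)
          · rw [ih _ hi _ s hs.1]
            simp only [Pi.sub_apply, Finset.sum_sub_distrib, Finset.sum_pi_single',
              Finset.mem_univ, if_true]
            push_cast at hsum
            omega
          · rw [transDet_sub_single_eq_zero hy hi, hwall _ _ hi, mul_zero, mul_zero]
        rw [Finset.mul_sum, Finset.sum_congr rfl fun i _ => h3 i, ← Finset.mul_sum]
        ring
      · intro s _
        exact ((hasDerivAt_transDet a y s).const_mul c).hasDerivWithinAt
      · exact (Continuous.continuousOn (by fun_prop)).mul ((hcont y hy).mono Icc_subset_Ici_self)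
      · exact continuousOn_const.mul fun s _ =>
          (hasDerivAt_transDet a y s).continuousAt.continuousWithinAt
      · simp only [mul_zero, Real.exp_zero, one_mul, hinit, transDet_zero ha hy]
        split_ifs <;> simp
  have h := main (∑ i, y i).toNat.succ y hy (by push_cast; omega) t ht
  rw [mul_right_comm, ← h, mul_right_comm, ← Real.exp_add]
  simp

end ForwardEquation

/-! ### Ordered paths and single steps -/

section Paths

variable {Ω : Type*} {n : ℕ}

/-- The buses are in strictly decreasing order during `[0, t]`. -/
def orderedUpTo (X : Fin n → ℝ≥0 → Ω → ℕ) (t : ℝ≥0) : Set Ω :=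
  {ω | ∀ s ≤ t, StrictAnti fun i => shiftedPos X i s ω}

/-- The buses are at the shifted positions `y` at time `t`. -/
def atConf (X : Fin n → ℝ≥0 → Ω → ℕ) (t : ℝ≥0) (y : Fin n → ℤ) : Set Ω :=
  {ω | ∀ i, shiftedPos X i t ω = y i}

/-- The displacement in which nobody moves (`none`), or only bus `i` moves, by one (`some i`). -/
def stepVec : Option (Fin n) → Fin n → ℕ
  | none => 0
  | some i => Pi.single i 1

/-- The increments over `[t, t']` are given by `stepVec o`. -/
def stepSet (X : Fin n → ℝ≥0 → Ω → ℕ) (t t' : ℝ≥0) (o : Option (Fin n)) : Set Ω :=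
  {ω | ∀ i, X i t' ω - X i t ω = stepVec o i}

variable {X : Fin n → ℝ≥0 → Ω → ℕ}

lemma orderedUpTo_anti {t t' : ℝ≥0} (h : t ≤ t') : orderedUpTo X t' ⊆ orderedUpTo X t :=
  fun _ hω s hs => hω s (hs.trans h)

lemma stepVec_injective : Function.Injective (stepVec (n := n)) := by
  intro o o' h
  rcases o with _ | i <;> rcases o' with _ | j
  · rfl
  · have := congrFun h j
    simp [stepVec] at this
  · have := congrFun h i
    simp [stepVec] at this
  · have := congrFun h i
    by_cases hij : i = j
    · rw [hij]
    · simp [stepVec, hij] at this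

lemma disjoint_stepSet (t t' : ℝ≥0) {o o' : Option (Fin n)} (h : o ≠ o') :
    Disjoint (stepSet X t t' o) (stepSet X t t' o') :=
  Set.disjoint_left.2 fun _ hω hω' =>
    h (stepVec_injective (funext fun i => (hω i).symm.trans (hω' i)))

lemma measurableSet_stepSet {mΩ : MeasurableSpace Ω} {t t' : ℝ≥0}
    (h : ∀ i s, s ≤ t' → Measurable (X i s)) (htt' : t ≤ t') (o : Option (Fin n)) :
    MeasurableSet (stepSet X t t' o) := by
  have : stepSet X t t' o = ⋂ i, (fun ω => X i t' ω - X i t ω) ⁻¹' {stepVec o i} := by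
    ext ω; simp [stepSet]
  rw [this]
  exact MeasurableSet.iInter fun i =>
    ((h i t' le_rfl).sub (h i t htt')) (measurableSet_singleton _)

lemma shiftedPos_add (hmono : ∀ i ω, Monotone fun t => X i t ω) {t t' : ℝ≥0} (htt' : t ≤ t')
    {o : Option (Fin n)} {ω : Ω} (hω : ω ∈ stepSet X t t' o) (i : Fin n) :
    shiftedPos X i t' ω = shiftedPos X i t ω + stepVec o i := by
  have h1 : X i t ω ≤ X i t' ω := hmono i ω htt'
  have h2 := hω i
  simp only [shiftedPos, busPos]
  omega

/-- During a time interval with at most one jump, the configuration is the initial or the final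
one. -/
lemma shiftedPos_eq_or_eq (hmono : ∀ i ω, Monotone fun t => X i t ω) {t s t' : ℝ≥0} (hts : t ≤ s)
    (hst' : s ≤ t') {o : Option (Fin n)} {ω : Ω} (hω : ω ∈ stepSet X t t' o) :
    (∀ i, shiftedPos X i s ω = shiftedPos X i t ω) ∨
      (∀ i, shiftedPos X i s ω = shiftedPos X i t' ω) := by
  have h1 : ∀ i, X i t ω ≤ X i s ω := fun i => hmono i ω hts
  have h2 : ∀ i, X i s ω ≤ X i t' ω := fun i => hmono i ω hst'
  simp only [shiftedPos, busPos]
  rcases o with _ | j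
  · left
    intro i
    have := hω i
    simp only [stepVec, Pi.zero_apply] at this
    have := h1 i; have := h2 i
    omega
  · have hj : ∀ i, i ≠ j → X i s ω = X i t ω ∧ X i s ω = X i t' ω := fun i hi => by
      have := hω i
      simp only [stepVec, Pi.single_eq_of_ne hi] at this
      have := h1 i; have := h2 i
      omega
    have hjj : X j s ω = X j t ω ∨ X j s ω = X j t' ω := by
      have := hω j
      simp only [stepVec, Pi.single_eq_same] at this
      have := h1 j; have := h2 j
      omega
    rcases hjj with h | h
    · left
      intro i
      by_cases hi : i = j
      · rw [hi, h]
      · rw [(hj i hi).1]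
    · right
      intro i
      by_cases hi : i = j
      · rw [hi, h]
      · rw [(hj i hi).2]

lemma shiftedPos_nonneg (i : Fin n) (t : ℝ≥0) (ω : Ω) : 0 ≤ shiftedPos X i t ω := by
  have := i.2
  simp only [shiftedPos, busPos]
  omega

/-- Being ordered during `[0, t]` is decided by the past of `t`: by right continuity, it suffices to
look at a countable dense set of times and at `t` itself. -/
lemma measurableSet_orderedUpTo
    (hrc : ∀ i ω t, ContinuousWithinAt (fun s => X i s ω) (Ici t) t) (t : ℝ≥0) :
    MeasurableSet[pastAlgebra X t] (orderedUpTo X t) := by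
  obtain ⟨D, hDc, hDd⟩ := TopologicalSpace.exists_countable_dense ℝ≥0
  have e : orderedUpTo X t =
      ⋂ s ∈ (D ∩ Iic t) ∪ {t}, {ω | StrictAnti fun i => shiftedPos X i s ω} := by
    ext ω
    simp only [mem_iInter]
    constructor
    · rintro hω s (hs | rfl)
      · exact hω s hs.2
      · exact hω _ le_rfl
    · intro hω s hs
      rcases hs.eq_or_lt with rfl | hs
      · exact hω s (Or.inr rfl)
      have hev : ∀ᶠ r in 𝓝[≥] s, ∀ i, X i r ω = X i s ω := by
        rw [Filter.eventually_all]
        intro i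
        exact (hrc i ω s).eventually ((isOpen_discrete {X i s ω}).mem_nhds rfl)
      obtain ⟨v, hv, hsub⟩ := mem_nhdsGE_iff_exists_Ico_subset.1 hev
      obtain ⟨r, hrD, hr⟩ := hDd.exists_mem_open isOpen_Ioo (nonempty_Ioo.2 (lt_min hv hs))
      have h1 := hsub ⟨hr.1.le, hr.2.trans_le (min_le_left _ _)⟩
      have h2 := hω r (Or.inl ⟨hrD, (hr.2.trans_le (min_le_right _ _)).le⟩)
      simp only [mem_ofPred_eq, shiftedPos, busPos] at h1 h2 ⊢
      simpa only [h1] using h2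
  rw [e]
  refine MeasurableSet.biInter ((hDc.mono inter_subset_left).union (countable_singleton t))
    fun s hs => ?_
  have hst : s ≤ t := by
    rcases hs with hs | rfl
    · exact hs.2
    · exact le_rfl
  have : {ω | StrictAnti fun i => shiftedPos X i s ω} =
      ⋂ i, ⋂ j, ⋂ (_ : i < j), {ω | shiftedPos X j s ω < shiftedPos X i s ω} := by
    ext ω
    simp [StrictAnti]
  rw [this]
  have hm : ∀ i, Measurable[pastAlgebra X t] (shiftedPos X i s) := fun i => by
    have h1 : Measurable fun k : ℕ => (k : ℤ) - (i : ℕ) + n - 1 := measurable_from_top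
    exact h1.comp (measurable_pastAlgebra hst i)
  exact MeasurableSet.iInter fun i => MeasurableSet.iInter fun j => MeasurableSet.iInter fun _ =>
    measurableSet_lt (hm j) (hm i)

lemma measurableSet_atConf {s t : ℝ≥0} (hst : s ≤ t) (y : Fin n → ℤ) :
    MeasurableSet[pastAlgebra X t] (atConf X s y) := by
  have hm : ∀ i, Measurable[pastAlgebra X t] (shiftedPos X i s) := fun i => by
    have h1 : Measurable fun k : ℕ => (k : ℤ) - (i : ℕ) + n - 1 := measurable_from_top
    exact h1.comp (measurable_pastAlgebra hst i)
  have : atConf X s y = ⋂ i, shiftedPos X i s ⁻¹' {y i} := by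
    ext ω; simp [atConf]
  rw [this]
  exact MeasurableSet.iInter fun i => hm i (measurableSet_singleton _)

/-- If only a single jump occurs during `[t, t']`, an ordered path up to `t'` ending at `y` is an
ordered path up to `t` ending one step earlier. -/
lemma orderedUpTo_inter_atConf_inter_stepSet (hmono : ∀ i ω, Monotone fun t => X i t ω)
    {t t' : ℝ≥0} (htt' : t ≤ t') {y : Fin n → ℤ} (hy : StrictAnti y) (o : Option (Fin n)) :
    orderedUpTo X t' ∩ atConf X t' y ∩ stepSet X t t' o =
      orderedUpTo X t ∩ atConf X t (fun i => y i - stepVec o i) ∩ stepSet X t t' o := by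
  ext ω
  constructor
  · rintro ⟨⟨h1, h2⟩, h3⟩
    refine ⟨⟨orderedUpTo_anti htt' h1, fun i => ?_⟩, h3⟩
    have := shiftedPos_add hmono htt' h3 i
    rw [h2 i] at this
    exact (sub_eq_of_eq_add this).symm
  · rintro ⟨⟨h1, h2⟩, h3⟩
    have hy' : ∀ i, shiftedPos X i t' ω = y i := fun i => by
      rw [shiftedPos_add hmono htt' h3 i, h2 i]
      ring
    refine ⟨⟨fun s hs => ?_, hy'⟩, h3⟩
    rcases le_total s t with hst | hts
    · exact h1 s hst
    · rcases shiftedPos_eq_or_eq hmono hts hs h3 with h | h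
      · simpa only [h] using h1 t le_rfl
      · simpa only [h, hy'] using hy

end Paths

/-! ### The Karlin–McGregor formula -/

section KarlinMcGregor

variable {Ω : Type*} [MeasurableSpace Ω] {P : Measure Ω} [IsProbabilityMeasure P] {n : ℕ}
  {X : Fin n → ℝ≥0 → Ω → ℕ}

lemma measureReal_inter_stepSet (hX : ∀ i, IsPoissonProcess (X i) 1 P)
    (hX_indep : iIndepFun (fun i ω s => X i s ω) P) {t t' : ℝ≥0} (htt' : t ≤ t') {F : Set Ω}
    (hF : MeasurableSet[pastAlgebra X t] F) (o : Option (Fin n)) :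
    P.real (F ∩ stepSet X t t' o) = P.real F *
      (Real.exp (-(n * ((t' : ℝ) - t))) * if o = none then 1 else (t' : ℝ) - t) := by
  rw [stepSet, measureReal_inter_increments hX hX_indep htt' hF, Finset.prod_div_distrib,
    Finset.prod_mul_distrib, NNReal.coe_sub htt']
  congr 1
  rw [Finset.prod_const, ← Real.exp_nat_mul, Finset.card_univ, Fintype.card_fin, mul_neg]
  rcases o with _ | i
  · simp [stepVec]
  · have h1 : ∏ j, ((t' : ℝ) - t) ^ stepVec (some i) j = (t' : ℝ) - t := by
      rw [Finset.prod_pow_eq_pow_sum]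
      simp [stepVec]
    have h2 : ∏ j, ((stepVec (some i) j)! : ℝ) = 1 := by
      refine Finset.prod_eq_one fun j _ => ?_
      by_cases hj : j = i
      · subst hj; simp [stepVec]
      · simp [stepVec, hj]
    rw [h1, h2]
    simp

/-- With probability `1 - O((t' - t) ^ 2)`, at most one jump occurs during `[t, t']`. -/
lemma measureReal_compl_iUnion_stepSet (hX : ∀ i, IsPoissonProcess (X i) 1 P)
    (hX_indep : iIndepFun (fun i ω s => X i s ω) P) {t t' : ℝ≥0} (htt' : t ≤ t') :
    P.real (⋃ o, stepSet X t t' o)ᶜ =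
      1 - Real.exp (-(n * ((t' : ℝ) - t))) * (1 + n * ((t' : ℝ) - t)) := by
  have hm : ∀ o, MeasurableSet (stepSet X t t' o) := fun o =>
    measurableSet_stepSet (fun i s _ => (hX i).measurable s) htt' o
  rw [probReal_compl_eq_one_sub (MeasurableSet.iUnion hm),
    measureReal_iUnion_fintype (fun o o' h => disjoint_stepSet t t' h) hm]
  have := fun o => measureReal_inter_stepSet hX hX_indep htt' MeasurableSet.univ o
  simp only [univ_inter, probReal_univ, one_mul] at this
  simp only [this, Fintype.sum_option]
  simp
  ring

/-- The one-step (Kolmogorov forward) estimate. -/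
lemma abs_measureReal_step_sub_le (hX : ∀ i, IsPoissonProcess (X i) 1 P)
    (hX_indep : iIndepFun (fun i ω s => X i s ω) P) {t₀ t t' : ℝ≥0} (ht₀ : t₀ ≤ t) (htt' : t ≤ t')
    {F : Set Ω} (hF : MeasurableSet[pastAlgebra X t₀] F) {y : Fin n → ℤ} (hy : StrictAnti y) :
    |P.real (F ∩ (orderedUpTo X t' ∩ atConf X t' y)) - Real.exp (-(n * ((t' : ℝ) - t))) *
      (P.real (F ∩ (orderedUpTo X t ∩ atConf X t y)) + ((t' : ℝ) - t) *
        ∑ i, P.real (F ∩ (orderedUpTo X t ∩ atConf X t (y - Pi.single i 1))))| ≤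
      1 - Real.exp (-(n * ((t' : ℝ) - t))) * (1 + n * ((t' : ℝ) - t)) := by
  have hm : ∀ o, MeasurableSet (stepSet X t t' o) := fun o =>
    measurableSet_stepSet (fun i s _ => (hX i).measurable s) htt' o
  have hG : ∀ y, MeasurableSet[pastAlgebra X t] (F ∩ (orderedUpTo X t ∩ atConf X t y)) := fun y =>
    (pastAlgebra_mono ht₀ F hF).inter
      ((measurableSet_orderedUpTo (fun i => (hX i).right_continuous) t).inter
        (measurableSet_atConf le_rfl y))
  set G' := F ∩ (orderedUpTo X t' ∩ atConf X t' y) with hG'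
  have h1 : ∀ o, P.real (G' ∩ stepSet X t t' o) =
      P.real (F ∩ (orderedUpTo X t ∩ atConf X t fun i => y i - stepVec o i)) *
        (Real.exp (-(n * ((t' : ℝ) - t))) * if o = none then 1 else (t' : ℝ) - t) := fun o => by
    rw [← measureReal_inter_stepSet hX hX_indep htt' (hG _), hG', inter_assoc,
      orderedUpTo_inter_atConf_inter_stepSet (fun i => (hX i).monotone) htt' hy, ← inter_assoc]
  have h2 : P.real (G' ∩ ⋃ o, stepSet X t t' o) = ∑ o, P.real (G' ∩ stepSet X t t' o) := by
    have := measureReal_iUnion_fintype (μ := P.restrict G')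
      (fun o o' h => disjoint_stepSet (X := X) t t' h) hm
    rw [measureReal_restrict_apply (MeasurableSet.iUnion hm)] at this
    rw [inter_comm, this]
    exact Finset.sum_congr rfl fun o _ => by rw [measureReal_restrict_apply (hm o), inter_comm]
  have h3 := measureReal_inter_add_sdiff (μ := P) (s := G') (MeasurableSet.iUnion hm)
  have h4 : P.real (G' \ ⋃ o, stepSet X t t' o) ≤
      1 - Real.exp (-(n * ((t' : ℝ) - t))) * (1 + n * ((t' : ℝ) - t)) := by
    rw [← measureReal_compl_iUnion_stepSet hX hX_indep htt']
    exact measureReal_mono fun ω hω => hω.2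
  have h5 : ∑ o, P.real (G' ∩ stepSet X t t' o) = Real.exp (-(n * ((t' : ℝ) - t))) *
      (P.real (F ∩ (orderedUpTo X t ∩ atConf X t y)) + ((t' : ℝ) - t) *
        ∑ i, P.real (F ∩ (orderedUpTo X t ∩ atConf X t (y - Pi.single i 1)))) := by
    have h6 : ∀ i, (fun j => y j - (stepVec (some i) j : ℤ)) = y - Pi.single i 1 := fun i => by
      ext j
      by_cases hj : j = i
      · subst hj; simp [stepVec]
      · simp [stepVec, hj]
    have h7 : (fun j => y j - (stepVec none j : ℤ)) = y := by
      ext j; simp [stepVec]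
    simp only [h1, Fintype.sum_option, h6, h7, if_true, reduceCtorEq, if_false]
    rw [← Finset.sum_mul]
    ring
  rw [← h3, h2, h5, add_sub_cancel_left, abs_of_nonneg measureReal_nonneg]
  exact h4

/-- **Karlin–McGregor formula** for Poisson walks, started from an event of the past. -/
theorem measureReal_inter_orderedUpTo_inter_atConf (hX : ∀ i, IsPoissonProcess (X i) 1 P)
    (hX_indep : iIndepFun (fun i ω s => X i s ω) P) {t₀ t : ℝ≥0} (ht : t₀ ≤ t)
    {F : Set Ω} (hF : MeasurableSet[pastAlgebra X t₀] F) {a : Fin n → ℤ} (ha : StrictAnti a)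
    (ha0 : ∀ i, 0 ≤ a i) (hF1 : F ⊆ orderedUpTo X t₀) (hF2 : F ⊆ atConf X t₀ a)
    {y : Fin n → ℤ} (hy : StrictAnti y) :
    P.real (F ∩ (orderedUpTo X t ∩ atConf X t y)) =
      P.real F * Real.exp (-(n * ((t : ℝ) - t₀))) * transDet a y ((t : ℝ) - t₀) := by
  have key := eq_transDet_of_step ha ha0 (c := P.real F)
    (fun y s => P.real (F ∩ (orderedUpTo X (t₀ + s.toNNReal) ∩ atConf X (t₀ + s.toNNReal) y)))
    (fun _ _ => measureReal_nonneg) (fun _ _ => measureReal_le_one) ?_ ?_ ?_ ?_ hy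
    (t := (t : ℝ) - t₀) (sub_nonneg.2 (by exact_mod_cast ht))
  · have e : t₀ + ((t : ℝ) - t₀).toNNReal = t := by
      rw [← NNReal.coe_sub ht, Real.toNNReal_coe, add_tsub_cancel_of_le ht]
    simpa only [e] using key
  · intro y s hy
    have : F ∩ (orderedUpTo X (t₀ + s.toNNReal) ∩ atConf X (t₀ + s.toNNReal) y) = ∅ := by
      ext ω
      simp only [mem_inter_iff, mem_empty_iff_false, iff_false, not_and]
      intro _ h1 h2
      refine hy ?_
      have := h1 _ le_rfl
      simpa only [h2 _] using this
    simp only [this, measureReal_empty]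
  · intro y s i hy
    have : F ∩ (orderedUpTo X (t₀ + s.toNNReal) ∩ atConf X (t₀ + s.toNNReal) y) = ∅ := by
      ext ω
      simp only [mem_inter_iff, mem_empty_iff_false, iff_false, not_and]
      intro _ _ h2
      have := shiftedPos_nonneg (X := X) i (t₀ + s.toNNReal) ω
      rw [h2 i] at this
      omega
    simp only [this, measureReal_empty]
  · intro y
    simp only [Real.toNNReal_zero, add_zero]
    split_ifs with h
    · subst h
      rw [inter_eq_left.2 (subset_inter hF1 hF2)]
    · have : F ∩ (orderedUpTo X t₀ ∩ atConf X t₀ y) = ∅ := by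
        ext ω
        simp only [mem_inter_iff, mem_empty_iff_false, iff_false, not_and]
        intro h1 _ h2
        exact h (funext fun i => (h2 i).symm.trans (hF2 h1 i))
      rw [this, measureReal_empty]
  · intro y hy s hs r hr
    have h := abs_measureReal_step_sub_le hX hX_indep (t₀ := t₀) (t := t₀ + s.toNNReal)
      (t' := t₀ + (s + r).toNNReal) le_self_add
      (by gcongr; linarith) hF hy
    have e : ((t₀ + (s + r).toNNReal : ℝ≥0) : ℝ) - ((t₀ + s.toNNReal : ℝ≥0) : ℝ) = r := by
      push_cast [Real.coe_toNNReal _ hs, Real.coe_toNNReal _ (add_nonneg hs hr)]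
      ring
    rwa [e] at h

/-- The starting configuration `n - 1, …, 0`. -/
def startConf (n : ℕ) (i : Fin n) : ℤ := n - 1 - (i : ℕ)

lemma strictAnti_startConf (n : ℕ) : StrictAnti (startConf n) := fun i j hij => by
  have : (i : ℕ) < j := hij
  simp only [startConf]
  omega

lemma startConf_nonneg {n : ℕ} (i : Fin n) : 0 ≤ startConf n i := by
  have := i.2
  simp only [startConf]
  omega

/-- The multi-time law of the ordered system. -/
theorem measureReal_orderedUpTo_inter_iInter_atConf (hX : ∀ i, IsPoissonProcess (X i) 1 P)
    (hX_indep : iIndepFun (fun i ω s => X i s ω) P) (m : ℕ) (t : Fin (m + 1) → ℝ≥0)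
    (ht : Monotone t) (x : Fin (m + 1) → Fin n → ℤ) (hx : ∀ j, StrictAnti (x j))
    (hx0 : ∀ j i, 0 ≤ x j i) :
    P.real (orderedUpTo X (t (Fin.last m)) ∩ {ω | ∀ j, ω ∈ atConf X (t j) (x j)}) =
      Real.exp (-(n * (t (Fin.last m) : ℝ))) * (transDet (startConf n) (x 0) (t 0) *
        ∏ l : Fin m, transDet (x l.castSucc) (x l.succ) ((t l.succ : ℝ) - t l.castSucc)) := by
  have hpos : ∀ ω i, shiftedPos X i 0 ω = startConf n i := fun ω i => by
    simp only [shiftedPos, busPos, (hX i).start_zero, startConf]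
    push_cast
    ring
  induction m with
  | zero =>
    have h := measureReal_inter_orderedUpTo_inter_atConf hX hX_indep (t₀ := 0) (t := t 0)
      zero_le (F := univ) MeasurableSet.univ (strictAnti_startConf n) startConf_nonneg
      (fun ω _ s hs => by
        obtain rfl : s = 0 := le_antisymm hs zero_le
        simpa only [hpos] using strictAnti_startConf n)
      (fun ω _ i => hpos ω i) (hx 0)
    have e : {ω | ∀ j : Fin 1, ω ∈ atConf X (t j) (x j)} = atConf X (t 0) (x 0) := by
      ext ω; simp [Fin.forall_fin_one]
    simp only [univ_inter, probReal_univ, NNReal.coe_zero, sub_zero, one_mul] at h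
    simpa [e] using h
  | succ m ih =>
    have ih' := ih (fun j => t j.castSucc) (fun i j h => ht (by simpa using h))
      (fun j => x j.castSucc) (fun j => hx _) fun j => hx0 _
    set F := orderedUpTo X (t (Fin.last m).castSucc) ∩
      {ω | ∀ j : Fin (m + 1), ω ∈ atConf X (t j.castSucc) (x j.castSucc)} with hF
    have hle : t (Fin.last m).castSucc ≤ t (Fin.last (m + 1)) := ht (Fin.le_last _)
    have hFm : MeasurableSet[pastAlgebra X (t (Fin.last m).castSucc)] F := by
      refine (measurableSet_orderedUpTo (fun i => (hX i).right_continuous) _).inter ?_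
      have : {ω | ∀ j : Fin (m + 1), ω ∈ atConf X (t j.castSucc) (x j.castSucc)} =
          ⋂ j : Fin (m + 1), atConf X (t j.castSucc) (x j.castSucc) := by
        ext; simp
      rw [this]
      exact MeasurableSet.iInter fun j =>
        measurableSet_atConf (ht (by simpa using Fin.le_last j)) _
    have h := measureReal_inter_orderedUpTo_inter_atConf hX hX_indep hle hFm
      (hx (Fin.last m).castSucc) (hx0 _) inter_subset_left (fun ω hω => hω.2 (Fin.last m))
      (hx (Fin.last (m + 1)))
    have e : orderedUpTo X (t (Fin.last (m + 1))) ∩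
        {ω | ∀ j : Fin (m + 2), ω ∈ atConf X (t j) (x j)} =
        F ∩ (orderedUpTo X (t (Fin.last (m + 1))) ∩
          atConf X (t (Fin.last (m + 1))) (x (Fin.last (m + 1)))) := by
      ext ω
      simp only [hF, mem_inter_iff, mem_ofPred_eq, Fin.forall_fin_succ' (n := m + 1)]
      have := @orderedUpTo_anti _ _ X _ _ hle ω
      tauto
    have e2 : Real.exp (-(n * (t (Fin.last (m + 1)) : ℝ))) =
        Real.exp (-(n * (t (Fin.last m).castSucc : ℝ))) *
          Real.exp (-(n * ((t (Fin.last (m + 1)) : ℝ) - t (Fin.last m).castSucc))) := by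
      rw [← Real.exp_add]
      congr 1
      ring
    rw [e, h, ih', Fin.prod_univ_castSucc, e2, Fin.succ_last]
    simp only [Fin.succ_castSucc, Fin.castSucc_zero]
    ring

/-- Almost surely, buses that never meet keep their order: without a simultaneous pair of jumps
in a cell of a fine time grid, no overtaking is possible. -/
theorem measureReal_never_meet_diff_orderedUpTo (hX : ∀ i, IsPoissonProcess (X i) 1 P)
    (hX_indep : iIndepFun (fun i ω s => X i s ω) P) (T : ℝ≥0) :
    P.real ({ω | ∀ t ≤ T, ∀ i j, i ≠ j → busPos X i t ω ≠ busPos X j t ω} \ orderedUpTo X T) =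
      0 := by
  set D := {ω | ∀ t ≤ T, ∀ i j, i ≠ j → busPos X i t ω ≠ busPos X j t ω} \ orderedUpTo X T with hD
  have key : ∀ k : ℕ, P.real D ≤ (n * (T : ℝ)) ^ 2 / ((k : ℝ) + 1) := by
    intro k
    -- the grid of `k + 1` cells of equal length
    set g : ℕ → ℝ≥0 := fun l => T * l / (k + 1) with hg
    have hgmono : ∀ l, g l ≤ g (l + 1) := fun l => by
      simp only [hg]
      gcongr
      simp
    have hg0 : g 0 = 0 := by simp [hg]
    have hgk : g (k + 1) = T := by
      simp only [hg]
      push_cast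
      rw [mul_div_assoc, div_self (by positivity), mul_one]
    have hsub : D ⊆ ⋃ l ∈ Finset.range (k + 1), (⋃ o, stepSet X (g l) (g (l + 1)) o)ᶜ := by
      intro ω hω
      by_contra hcon
      simp only [mem_iUnion, not_exists, Finset.mem_range, mem_compl_iff] at hcon
      refine hω.2 ?_
      have hord : ∀ l ≤ k + 1, ω ∈ orderedUpTo X (g l) := by
        intro l
        induction l with
        | zero =>
          intro _ s hs
          rw [hg0] at hs
          obtain rfl : s = 0 := le_antisymm hs zero_le
          have : ∀ i, shiftedPos X i 0 ω = startConf n i := fun i => by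
            simp only [shiftedPos, busPos, (hX i).start_zero, startConf]
            push_cast
            ring
          simpa only [this] using strictAnti_startConf n
        | succ l ih =>
          intro hl s hs
          have ih' := ih (by omega)
          rcases le_total s (g l) with h | h
          · exact ih' s h
          obtain ⟨o, ho⟩ := not_forall_not.1 (hcon l (by omega))
          have hm := fun i => (hX i).monotone
          have h0 := ih' (g l) le_rfl
          -- an ordered configuration stays weakly ordered after one step
          have h1 : ∀ i j, i < j → shiftedPos X j (g (l + 1)) ω ≤ shiftedPos X i (g (l + 1)) ω := by
            intro i j hij
            rw [shiftedPos_add hm (hgmono l) ho, shiftedPos_add hm (hgmono l) ho]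
            have h2 := h0 hij
            have h3 : stepVec o j ≤ 1 := by
              rcases o with _ | o
              · simp [stepVec]
              · by_cases hj : j = o
                · subst hj; simp [stepVec]
                · simp [stepVec, hj]
            simp only at h2
            omega
          rcases shiftedPos_eq_or_eq hm h hs ho with h2 | h2
          · simpa only [h2] using h0
          · intro i j hij
            have h3 : s ≤ T := hs.trans (by
              rw [← hgk]
              exact (monotone_nat_of_le_succ hgmono) hl)
            have h4 := hω.1 s h3 i j hij.ne
            have h5 := h1 i j hij
            rw [← h2 i, ← h2 j] at h5
            refine lt_of_le_of_ne h5 fun h6 => h4 ?_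
            simp only [shiftedPos] at h6
            omega
      have := hord (k + 1) le_rfl
      rwa [hgk] at this
    have hcell : ∀ l ∈ Finset.range (k + 1), P.real (⋃ o, stepSet X (g l) (g (l + 1)) o)ᶜ ≤
        (n * (T : ℝ) / ((k : ℝ) + 1)) ^ 2 := by
      intro l _
      rw [measureReal_compl_iUnion_stepSet hX hX_indep (hgmono l)]
      have e : n * ((g (l + 1) : ℝ) - g l) = n * (T : ℝ) / ((k : ℝ) + 1) := by
        simp only [hg]
        push_cast
        field_simp
        ring
      rw [e]
      set z := n * (T : ℝ) / ((k : ℝ) + 1)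
      have hz : 0 ≤ z := by positivity
      have := Real.one_sub_le_exp_neg z
      nlinarith
    calc P.real D ≤ P.real (⋃ l ∈ Finset.range (k + 1), (⋃ o, stepSet X (g l) (g (l + 1)) o)ᶜ) :=
          measureReal_mono hsub (measure_ne_top _ _)
      _ ≤ ∑ l ∈ Finset.range (k + 1), P.real (⋃ o, stepSet X (g l) (g (l + 1)) o)ᶜ :=
          measureReal_biUnion_finset_le _ _
      _ ≤ ∑ l ∈ Finset.range (k + 1), (n * (T : ℝ) / ((k : ℝ) + 1)) ^ 2 := Finset.sum_le_sum hcell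
      _ = (n * (T : ℝ)) ^ 2 / ((k : ℝ) + 1) := by
          rw [Finset.sum_const, Finset.card_range, nsmul_eq_mul]
          push_cast
          field_simp
  have hlim : Filter.Tendsto (fun k : ℕ => (n * (T : ℝ)) ^ 2 / ((k : ℝ) + 1)) Filter.atTop (𝓝 0) :=
    ((tendsto_const_div_atTop_nhds_zero_nat ((n * (T : ℝ)) ^ 2)).comp
      (Filter.tendsto_add_atTop_nat 1)).congr fun k => by simp
  exact le_antisymm (ge_of_tendsto' hlim key) measureReal_nonneg

/-- The final configuration, in shifted coordinates. -/
def endConf (n N : ℕ) (i : Fin n) : ℤ := N + n - 1 - (i : ℕ)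

/-- Up to a null set, the conditioning event says that the buses stay ordered and end at
`endConf`. -/
lemma busEvent_ae_eq (hX : ∀ i, IsPoissonProcess (X i) 1 P)
    (hX_indep : iIndepFun (fun i ω s => X i s ω) P) (N : ℕ) (T : ℝ≥0) :
    busEvent X N T =ᵐ[P] (orderedUpTo X T ∩ atConf X T (endConf n N) : Set Ω) := by
  have h := measureReal_never_meet_diff_orderedUpTo hX hX_indep T
  rw [measureReal_eq_zero_iff] at h
  have hend : ∀ ω, (∀ i : Fin n, busPos X i T ω = (N : ℤ) - (i : ℕ)) ↔
      ω ∈ atConf X T (endConf n N) := fun ω => by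
    refine forall_congr' fun i => ?_
    simp only [shiftedPos, endConf]
    omega
  have h' : ∀ᵐ ω ∂P, ω ∉ ({ω | ∀ t ≤ T, ∀ i j, i ≠ j → busPos X i t ω ≠ busPos X j t ω} \
      orderedUpTo X T) := compl_mem_ae_iff.2 h
  refine Filter.eventuallyEq_set.2 ?_
  filter_upwards [h'] with ω hω
  simp only [busEvent, mem_ofPred_eq, hend, mem_inter_iff]
  refine and_congr_left fun _ => ⟨fun h1 => ?_, fun h1 t ht i j hij h2 => ?_⟩
  · by_contra h2
    exact hω ⟨h1, h2⟩
  · refine hij ((h1 t ht).injective ?_)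
    simp only [shiftedPos, h2]

end KarlinMcGregor

/-! ### Vandermonde determinants at the two ends -/

section BoundaryDeterminants

variable {n : ℕ}

lemma binomTrans_eq_V {x : ℕ} (r : ℝ) (y : ℕ) : binomTrans r x y = (y ! : ℝ) / x ! * V r x y := by
  rw [binomTrans, V]
  split_ifs with h
  · rw [Nat.cast_choose ℝ h]
    field_simp
  · rw [Nat.choose_eq_zero_of_lt (not_le.1 h)]
    simp

lemma V_eq_binomTrans {x : ℕ} (r : ℝ) (y : ℕ) :
    V r x y = (x ! : ℝ) * ((y ! : ℝ)⁻¹ * binomTrans r x y) := by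
  rw [binomTrans_eq_V]
  field_simp

/-- A determinant of binomial transition weights out of `0, …, n - 1` is a Vandermonde
determinant, since `y.choose i` is a polynomial of degree `i` in `y`. -/
lemma det_binomTrans_val {q : ℝ} (hq : q ≠ 0) (y : Fin n → ℕ) :
    (Matrix.of fun i j : Fin n => binomTrans q i (y j)).det =
      (∏ i : Fin n, ((i : ℕ)! * q ^ (i : ℕ)))⁻¹ *
        ((∏ i, q ^ y i) * ∏ i, ∏ j ∈ Finset.Ioi i, ((y j : ℝ) - y i)) := by
  have h1 : (Matrix.of fun i j : Fin n => binomTrans q i (y j)) =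
      Matrix.of fun i j : Fin n => ((i : ℕ)! * q ^ (i : ℕ))⁻¹ *
        (Matrix.of fun i j : Fin n => q ^ y j *
          (Matrix.of fun i j : Fin n =>
            (descPochhammer ℝ j).eval (y i : ℝ)).transpose i j) i j := by
    ext i j
    simp only [Matrix.of_apply, Matrix.transpose_apply, descPochhammer_eval_eq_descFactorial,
      binomTrans, Nat.descFactorial_eq_factorial_mul_choose]
    rcases le_or_gt (i : ℕ) (y j) with h | h
    · rw [pow_sub₀ q hq h]
      push_cast
      field_simp
    · simp [Nat.choose_eq_zero_of_lt h]
  rw [h1, Matrix.det_mul_column, Matrix.det_mul_row, Matrix.det_transpose,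
    ← Matrix.det_eval_matrixOfPolynomials_eq_det_vandermonde (fun i => (y i : ℝ))
      (fun j => descPochhammer ℝ j) (fun j => descPochhammer_natDegree ℝ j)
      (fun j => monic_descPochhammer ℝ j), Matrix.det_vandermonde, Finset.prod_inv_distrib]

lemma vandermondeProd_eq_rev (x : Fin n → ℕ) :
    vandermondeProd x =
      ∏ i : Fin n, ∏ j ∈ Finset.Ioi i, ((x (Fin.rev j) : ℝ) - x (Fin.rev i)) := by
  have h : ∀ f : Fin n → Fin n → ℝ, ∏ i, ∏ j ∈ Finset.Ioi i, f i j =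
      ∏ i, ∏ j, if i < j then f i j else 1 := fun f => by
    refine Finset.prod_congr rfl fun i _ => ?_
    rw [← Finset.prod_filter]
    congr 1
    ext; simp
  rw [vandermondeProd, h, h, Finset.prod_comm, ← Equiv.prod_comp Fin.revPerm]
  refine Finset.prod_congr rfl fun i _ => ?_
  rw [← Equiv.prod_comp Fin.revPerm]
  simp

/-- Transition weights out of the starting configuration `n - 1, …, 0`. -/
lemma det_binomTrans_start {p : ℝ} (hp : p ≠ 0) (x : Fin n → ℕ) :
    (Matrix.of fun i j : Fin n => binomTrans p (n - 1 - i) (x j)).det =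
      (∏ i : Fin n, ((i : ℕ)! * p ^ (i : ℕ)))⁻¹ * (vandermondeProd x * ∏ i, p ^ x i) := by
  rw [← Matrix.det_submatrix_equiv_self Fin.revPerm]
  have h := det_binomTrans_val hp fun j => x j.rev
  rw [vandermondeProd_eq_rev, mul_comm (∏ i, ∏ j ∈ _, _),
    ← Equiv.prod_comp Fin.revPerm fun i => p ^ x i]
  convert! h using 3
  ext i j
  have : n - 1 - (i.rev : ℕ) = i := by
    have := i.2
    rw [Fin.val_rev]
    omega
  change binomTrans p (n - 1 - (i.rev : ℕ)) (x j.rev) = binomTrans p i (x j.rev)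
  rw [this]

/-- Transition weights into the final configuration `d - 1, …, d - n`: reflecting the sites by
`y ↦ d - 1 - y` reduces them to `det_binomTrans_val`. -/
lemma det_binomTrans_end {d : ℕ} (hnd : n ≤ d) {q : ℝ} (hq : q ≠ 0) {x : Fin n → ℕ}
    (hx : ∀ i, x i < d) :
    (Matrix.of fun i j : Fin n => binomTrans q (x i) (d - 1 - j)).det =
      (∏ j : Fin n, ((d - 1 - j)! : ℝ) / q ^ (j : ℕ)) * (∏ i, ((x i)! : ℝ))⁻¹ *
        (vandermondeProd x * ∏ i, q ^ (d - 1 - x i) / ((d - 1 - x i)! : ℝ)) := by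
  have h1 : (Matrix.of fun i j : Fin n => binomTrans q (x i) (d - 1 - j)) =
      Matrix.of fun i j : Fin n => ((x i)! * ((d - 1 - x i)! : ℝ))⁻¹ *
        (Matrix.of fun i j : Fin n => ((j : ℕ)! * ((d - 1 - j)! : ℝ)) *
          (Matrix.of fun i j : Fin n => binomTrans q i (d - 1 - x j)).transpose i j) i j := by
    ext i j
    have h2 : V q (x i) (d - 1 - j) = V q j (d - 1 - x i) := by
      have := hx i
      have := j.2
      rw [V, V, show d - 1 - (j : ℕ) - x i = d - 1 - x i - j by omega]
      exact if_congr (by omega) rfl rfl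
    simp only [Matrix.of_apply, Matrix.transpose_apply, binomTrans_eq_V, h2]
    field_simp
  have h3 : vandermondeProd x =
      ∏ i, ∏ j ∈ Finset.Ioi i, (((d - 1 - x j : ℕ) : ℝ) - (d - 1 - x i : ℕ)) := by
    have h4 : ∀ i, ((d - 1 - x i : ℕ) : ℝ) = ((d - 1 : ℕ) : ℝ) - x i := fun i =>
      Nat.cast_sub (by have := hx i; omega)
    refine Finset.prod_congr rfl fun i _ => Finset.prod_congr rfl fun j _ => ?_
    rw [h4, h4]
    ring
  rw [h1, Matrix.det_mul_column, Matrix.det_mul_row, Matrix.det_transpose, det_binomTrans_val hq,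
    ← h3, Finset.prod_inv_distrib]
  simp only [Finset.prod_mul_distrib, Finset.prod_div_distrib]
  have f1 : (∏ i : Fin n, ((i : ℕ)! : ℝ)) ≠ 0 := by positivity
  have f2 : (∏ i : Fin n, q ^ (i : ℕ)) ≠ 0 := Finset.prod_ne_zero_iff.2 fun _ _ => pow_ne_zero _ hq
  field_simp

lemma vandermondeProd_pos {x : Fin n → ℕ} (hx : StrictAnti x) : 0 < vandermondeProd x :=
  Finset.prod_pos fun i _ => Finset.prod_pos fun j hj => by
    have := hx (Finset.mem_Ioi.1 hj)
    exact sub_pos.2 (by exact_mod_cast this)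

end BoundaryDeterminants

/-! ### Weights of chains of configurations -/

section ChainWeight

variable {n m : ℕ}

/-- The weight of the configurations `x 0, …, x m` in terms of the normalised transition weights
`binomTrans`, for paths from `n - 1, …, 0` to `d - 1, …, d - n`. -/
def chainWeight {K : Type*} [Field K] (d : ℕ) (p : Fin (m + 1) → K)
    (x : Fin (m + 1) → Fin n → ℕ) : K :=
  (Matrix.of fun i j : Fin n => binomTrans (p 0) (n - 1 - i) (x 0 j)).det *
    (∏ l : Fin m, (Matrix.of fun i j : Fin n =>
      binomTrans (p l.succ - p l.castSucc) (x l.castSucc i) (x l.succ j)).det) *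
    (Matrix.of fun i j : Fin n =>
      binomTrans (1 - p (Fin.last m)) (x (Fin.last m) i) (d - 1 - j)).det

/-- The sum of `chainWeight` over all chains of configurations. -/
def totalWeight (K : Type*) [Field K] (n d : ℕ) : K :=
  (Matrix.of fun i j : Fin n => binomTrans (1 : K) (n - 1 - i) (d - 1 - j)).det

lemma ofReal_det_binomTrans (r : ℝ) (x y : Fin n → ℕ) :
    (((Matrix.of fun i j => binomTrans r (x i) (y j)).det : ℝ) : ℂ) =
      (Matrix.of fun i j => binomTrans (r : ℂ) (x i) (y j)).det := by
  have := Complex.ofRealHom.map_det (Matrix.of fun i j => binomTrans r (x i) (y j))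
  rw [Complex.ofRealHom_eq_coe] at this
  rw [this]
  congr 1
  ext i j
  simp [binomTrans]

lemma ofReal_chainWeight (d : ℕ) (p : Fin (m + 1) → ℝ) (x : Fin (m + 1) → Fin n → ℕ) :
    ((chainWeight d p x : ℝ) : ℂ) = chainWeight d (fun j => (p j : ℂ)) x := by
  simp only [chainWeight, Complex.ofReal_mul, Complex.ofReal_prod, ← Complex.ofReal_sub,
    ofReal_det_binomTrans (p 0) (fun i => n - 1 - i) (x 0),
    ofReal_det_binomTrans _ (x (Fin.last m)) (fun j => d - 1 - j), ofReal_det_binomTrans]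
  push_cast
  rfl

lemma ofReal_totalWeight (n d : ℕ) : ((totalWeight ℝ n d : ℝ) : ℂ) = totalWeight ℂ n d := by
  have := ofReal_det_binomTrans 1 (fun i : Fin n => n - 1 - i) (fun j => d - 1 - j)
  rw [Complex.ofReal_one] at this
  exact this

lemma totalWeight_pos {d : ℕ} (hnd : n ≤ d) : 0 < totalWeight ℝ n d := by
  rw [totalWeight, det_binomTrans_start one_ne_zero fun j : Fin n => d - 1 - j]
  have : 0 < vandermondeProd fun j : Fin n => d - 1 - (j : ℕ) :=
    vandermondeProd_pos fun i j hij => by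
      have h1 : (i : ℕ) < j := hij
      have := j.2
      omega
  simp only [one_pow, mul_one, Finset.prod_const_one]
  positivity

lemma prod_div_castSucc (f : Fin (m + 1) → ℝ) (hf : ∀ j, f j ≠ 0) :
    ∏ l : Fin m, f l.succ / f l.castSucc = f (Fin.last m) / f 0 := by
  induction m with
  | zero => simp [div_self (hf 0)]
  | succ m ih =>
    have := ih (fun j => f j.castSucc) fun j => hf _
    simp only [Fin.castSucc_zero] at this
    rw [Fin.prod_univ_castSucc]
    simp only [Fin.succ_castSucc, Fin.succ_last]
    rw [this]
    have := hf (Fin.last m).castSucc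
    have := hf 0
    field_simp

/-- The explicit multi-time weight is a constant multiple of `chainWeight`. -/
theorem exists_chainWeight_eq_mul_multiTimeWeight {N : ℕ} {p : Fin (m + 1) → ℝ} (hp0 : 0 < p 0)
    (hp1 : p (Fin.last m) < 1) :
    ∃ c : ℝ, 0 < c ∧ ∀ x : Fin (m + 1) → Fin n → ℕ, (∀ j i, x j i < N + n) →
      chainWeight (N + n) p x = c * multiTimeWeight N p x := by
  have hq : 0 < 1 - p (Fin.last m) := by linarith
  refine ⟨(∏ i : Fin n, ((i : ℕ)! * p 0 ^ (i : ℕ)))⁻¹ *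
    ∏ j : Fin n, ((N + n - 1 - j)! : ℝ) / (1 - p (Fin.last m)) ^ (j : ℕ), by positivity,
    fun x hx => ?_⟩
  have h1 : ∀ l : Fin m, (Matrix.of fun a b : Fin n =>
      V (p l.succ - p l.castSucc) (x l.castSucc a) (x l.succ b)).det =
      ((∏ i, ((x l.succ i)! : ℝ)) / ∏ i, ((x l.castSucc i)! : ℝ))⁻¹ * (Matrix.of fun a b : Fin n =>
        binomTrans (p l.succ - p l.castSucc) (x l.castSucc a) (x l.succ b)).det := fun l => by
    simp only [V_eq_binomTrans]
    have := Matrix.det_mul_column (fun i => ((x l.castSucc i)! : ℝ)) (Matrix.of fun a b : Fin n =>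
      ((x l.succ b)! : ℝ)⁻¹ * (Matrix.of fun a b : Fin n =>
        binomTrans (p l.succ - p l.castSucc) (x l.castSucc a) (x l.succ b)) a b)
    rw [Matrix.det_mul_row] at this
    refine this.trans ?_
    rw [Finset.prod_inv_distrib, inv_div]
    ring
  have h2 := Finset.prod_congr rfl fun (l : Fin m) (_ : l ∈ Finset.univ) => h1 l
  rw [Finset.prod_mul_distrib, Finset.prod_inv_distrib,
    prod_div_castSucc (fun j => ∏ i, ((x j i)! : ℝ)) (fun j => by positivity)] at h2
  rw [chainWeight, det_binomTrans_start hp0.ne', det_binomTrans_end (by omega) hq.ne' (hx _),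
    multiTimeWeight, h2]
  simp only [Finset.prod_div_distrib]
  have f1 : ∀ j, (∏ i : Fin n, ((x j i)! : ℝ)) ≠ 0 := fun j => by positivity
  have f2 := f1 0
  have f3 := f1 (Fin.last m)
  field_simp

/-- `transDet` in terms of `binomTrans`: the two differ by a gauge factor. -/
lemma transDet_eq_mul_det_binomTrans {T : ℝ} (hT : T ≠ 0) (a y : Fin n → ℕ) (r : ℝ) :
    transDet (fun i => (a i : ℤ)) (fun i => (y i : ℤ)) (T * r) =
      (∏ i, T ^ y i / ((y i)! : ℝ)) / (∏ i, T ^ a i / ((a i)! : ℝ)) *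
        (Matrix.of fun i j => binomTrans r (a i) (y j)).det := by
  have h : (Matrix.of fun i j : Fin n => expTerm ((y j : ℤ) - a i) (T * r)) =
      Matrix.of fun i j : Fin n => (T ^ a i / ((a i)! : ℝ))⁻¹ *
        (Matrix.of fun i j : Fin n => (T ^ y j / ((y j)! : ℝ)) *
          (Matrix.of fun i j => binomTrans r (a i) (y j)) i j) i j := by
    ext i j
    simp only [Matrix.of_apply, binomTrans_eq_V, expTerm, V]
    by_cases hle : a i ≤ y j
    · have e : ((y j : ℤ) - a i).toNat = y j - a i := by omega
      rw [if_pos (by omega), if_pos hle, e, mul_pow, pow_sub₀ T hT hle]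
      field_simp
    · rw [if_neg (by omega), if_neg hle]
      simp
  rw [transDet, h, Matrix.det_mul_column, Matrix.det_mul_row, Finset.prod_inv_distrib]
  ring

end ChainWeight

/-! ### The conditional law -/

section ConditionalLaw

lemma measurableSet_ordered_end {Ω : Type*} [MeasurableSpace Ω] {P : Measure Ω} {n : ℕ}
    {X : Fin n → ℝ≥0 → Ω → ℕ} (hX : ∀ i, IsPoissonProcess (X i) 1 P) (N : ℕ) (T : ℝ≥0) :
    MeasurableSet (orderedUpTo X T ∩ atConf X T (endConf n N)) :=
  pastAlgebra_le (fun i t => (hX i).measurable t) T _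
    ((measurableSet_orderedUpTo (fun i => (hX i).right_continuous) T).inter
      (measurableSet_atConf le_rfl _))

variable {Ω : Type*} [MeasurableSpace Ω] {P : Measure Ω} [IsProbabilityMeasure P] {n m : ℕ}
  {X : Fin n → ℝ≥0 → Ω → ℕ}

lemma startConf_eq_natCast (n : ℕ) :
    startConf n = fun i : Fin n => ((n - 1 - (i : ℕ) : ℕ) : ℤ) := by
  ext i
  have := i.2
  simp only [startConf]
  omega

lemma endConf_eq_natCast (n N : ℕ) :
    endConf n N = fun i : Fin n => ((N + n - 1 - (i : ℕ) : ℕ) : ℤ) := by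
  ext i
  have := i.2
  simp only [endConf]
  omega

lemma strictAnti_endConf (n N : ℕ) : StrictAnti (endConf n N) := fun i j hij => by
  have : (i : ℕ) < j := hij
  simp only [endConf]
  omega

lemma endConf_nonneg {n : ℕ} (N : ℕ) (i : Fin n) : 0 ≤ endConf n N i := by
  have := i.2
  simp only [endConf]
  omega

/-- The probability that the ordered paths end at `endConf`, divided by `totalWeight`. -/
noncomputable def massFactor (n N : ℕ) (T : ℝ) : ℝ :=
  Real.exp (-(n * T)) * ((∏ i : Fin n, T ^ (N + n - 1 - i) / ((N + n - 1 - i)! : ℝ)) /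
    ∏ i : Fin n, T ^ (n - 1 - i) / ((n - 1 - i)! : ℝ))

lemma massFactor_pos (n N : ℕ) {T : ℝ} (hT : 0 < T) : 0 < massFactor n N T := by
  rw [massFactor]
  positivity

theorem measureReal_ordered_end (hX : ∀ i, IsPoissonProcess (X i) 1 P)
    (hX_indep : iIndepFun (fun i ω s => X i s ω) P) (N : ℕ) {T : ℝ≥0} (hT : 0 < T) :
    P.real (orderedUpTo X T ∩ atConf X T (endConf n N)) =
      massFactor n N T * totalWeight ℝ n (N + n) := by
  have h := measureReal_orderedUpTo_inter_iInter_atConf hX hX_indep 0 (fun _ => T)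
    (fun _ _ _ => le_rfl) (fun _ => endConf n N) (fun _ => strictAnti_endConf n N)
    (fun _ => endConf_nonneg N)
  have e : {ω | ∀ _ : Fin (0 + 1), ω ∈ atConf X T (endConf n N)} =
      atConf X T (endConf n N) := by
    ext ω; simp
  have h2 := transDet_eq_mul_det_binomTrans (T := T) (by exact_mod_cast hT.ne')
    (fun i : Fin n => n - 1 - i) (fun i : Fin n => N + n - 1 - i) 1
  rw [mul_one] at h2
  rw [e, Finset.univ_eq_empty, Finset.prod_empty, mul_one, startConf_eq_natCast,
    endConf_eq_natCast, h2, ← mul_assoc] at h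
  rw [endConf_eq_natCast, h]
  rfl

theorem measureReal_ordered_end_inter (hX : ∀ i, IsPoissonProcess (X i) 1 P)
    (hX_indep : iIndepFun (fun i ω s => X i s ω) P) (N : ℕ) {T : ℝ≥0} (hT : 0 < T)
    {t : Fin (m + 1) → ℝ≥0} (ht : Monotone t) (htT : t (Fin.last m) ≤ T) {p : Fin (m + 1) → ℝ}
    (hp : ∀ j, p j = (t j : ℝ) / (T : ℝ)) {x : Fin (m + 1) → Fin n → ℕ}
    (hx : ∀ j, StrictAnti (x j)) :
    P.real (orderedUpTo X T ∩ atConf X T (endConf n N) ∩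
        {ω | ∀ j i, shiftedPos X i (t j) ω = (x j i : ℤ)}) =
      massFactor n N T * chainWeight (N + n) p x := by
  have hT' : (T : ℝ) ≠ 0 := by exact_mod_cast hT.ne'
  have htp : ∀ j, (t j : ℝ) = T * p j := fun j => by rw [hp]; field_simp
  -- adjoin the final time and the final configuration
  set t' : Fin (m + 2) → ℝ≥0 := Fin.snoc t T with ht'
  set x' : Fin (m + 2) → Fin n → ℤ :=
    Fin.snoc (α := fun _ => Fin n → ℤ) (fun j i => (x j i : ℤ)) (endConf n N) with hx'
  have t1 : ∀ j : Fin (m + 1), t' j.castSucc = t j := fun j => by simp [ht']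
  have t2 : t' (Fin.last (m + 1)) = T := by simp [ht']
  have x1 : ∀ j : Fin (m + 1), x' j.castSucc = fun i => (x j i : ℤ) := fun j => by simp [hx']
  have x2 : x' (Fin.last (m + 1)) = endConf n N := by simp [hx']
  have h := measureReal_orderedUpTo_inter_iInter_atConf hX hX_indep (m + 1) t'
    (Fin.monotone_iff_le_succ.2 fun j => ?_) x' (fun j => ?_) (fun j => ?_)
  · have e : {ω | ∀ j : Fin (m + 2), ω ∈ atConf X (t' j) (x' j)} = atConf X T (endConf n N) ∩
        {ω | ∀ j i, shiftedPos X i (t j) ω = (x j i : ℤ)} := by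
      ext ω
      rw [mem_ofPred_eq, Fin.forall_fin_succ' (n := m + 1)]
      simp only [t1, t2, x1, x2, atConf, mem_inter_iff, mem_ofPred_eq]
      tauto
    rw [e, t2, ← inter_assoc] at h
    have z1 : t' 0 = t 0 := t1 0
    have z2 : x' 0 = fun i => (x 0 i : ℤ) := x1 0
    rw [h, Fin.prod_univ_castSucc, z1, z2]
    simp only [Fin.succ_castSucc, t1, x1]
    rw [Fin.succ_last, t2, x2]
    have s1 : transDet (startConf n) (fun i => (x 0 i : ℤ)) (t 0) =
        (∏ i, (T : ℝ) ^ x 0 i / ((x 0 i)! : ℝ)) /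
          (∏ i : Fin n, (T : ℝ) ^ (n - 1 - i) / ((n - 1 - i)! : ℝ)) *
        (Matrix.of fun i j : Fin n => binomTrans (p 0) (n - 1 - i) (x 0 j)).det := by
      rw [startConf_eq_natCast, htp 0]
      exact transDet_eq_mul_det_binomTrans hT' (fun i : Fin n => n - 1 - i) (x 0) (p 0)
    have s2 : ∀ l : Fin m, transDet (fun i => (x l.castSucc i : ℤ)) (fun i => (x l.succ i : ℤ))
        ((t l.succ : ℝ) - t l.castSucc) =
        (∏ i, (T : ℝ) ^ x l.succ i / ((x l.succ i)! : ℝ)) /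
          (∏ i, (T : ℝ) ^ x l.castSucc i / ((x l.castSucc i)! : ℝ)) *
        (Matrix.of fun i j : Fin n =>
          binomTrans (p l.succ - p l.castSucc) (x l.castSucc i) (x l.succ j)).det := fun l => by
      rw [htp, htp, ← mul_sub]
      exact transDet_eq_mul_det_binomTrans hT' _ _ _
    have s3 : transDet (fun i => (x (Fin.last m) i : ℤ)) (endConf n N)
        ((T : ℝ) - t (Fin.last m)) =
        (∏ i : Fin n, (T : ℝ) ^ (N + n - 1 - i) / ((N + n - 1 - i)! : ℝ)) /
          (∏ i, (T : ℝ) ^ x (Fin.last m) i / ((x (Fin.last m) i)! : ℝ)) *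
        (Matrix.of fun i j : Fin n =>
          binomTrans (1 - p (Fin.last m)) (x (Fin.last m) i) (N + n - 1 - j)).det := by
      rw [endConf_eq_natCast, htp, show (T : ℝ) - T * p (Fin.last m) =
        T * (1 - p (Fin.last m)) by ring]
      exact transDet_eq_mul_det_binomTrans hT' _ (fun i : Fin n => N + n - 1 - i) _
    have hw : ∀ j, (∏ i, (T : ℝ) ^ x j i / ((x j i)! : ℝ)) ≠ 0 := fun j =>
      Finset.prod_ne_zero_iff.2 fun i _ => div_ne_zero (pow_ne_zero _ hT') (by positivity)
    -- the gauge factors telescope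
    have s4 := Finset.prod_congr rfl fun (l : Fin m) (_ : l ∈ Finset.univ) => s2 l
    rw [Finset.prod_mul_distrib, prod_div_castSucc
      (fun j => ∏ i, (T : ℝ) ^ x j i / ((x j i)! : ℝ)) hw] at s4
    rw [s1, s4, s3, massFactor, chainWeight]
    have w1 := hw 0
    have w2 := hw (Fin.last m)
    generalize (∏ i, (T : ℝ) ^ x 0 i / ((x 0 i)! : ℝ)) = a1 at *
    generalize (∏ i, (T : ℝ) ^ x (Fin.last m) i / ((x (Fin.last m) i)! : ℝ)) = a2 at *
    field_simp
  · refine Fin.lastCases ?_ (fun j => ?_) j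
    · rw [t1, Fin.succ_last, t2]
      exact htT
    · rw [t1, Fin.succ_castSucc, t1]
      exact ht (Fin.castSucc_le_succ j)
  · refine Fin.lastCases ?_ (fun j => ?_) j
    · rw [x2]
      exact strictAnti_endConf n N
    · rw [x1]
      exact fun a b hab => Int.ofNat_lt.2 (hx j hab)
  · refine Fin.lastCases ?_ (fun j => ?_) j
    · rw [x2]
      exact endConf_nonneg N
    · rw [x1]
      exact fun i => Int.natCast_nonneg _

lemma busLaw_eq_cond (hX : ∀ i, IsPoissonProcess (X i) 1 P)
    (hX_indep : iIndepFun (fun i ω s => X i s ω) P) (N : ℕ) (T : ℝ≥0) :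
    busLaw P X N T = P[|orderedUpTo X T ∩ atConf X T (endConf n N)] := by
  have h := busEvent_ae_eq hX hX_indep N T
  rw [busLaw, ProbabilityTheory.cond, ProbabilityTheory.cond, measure_congr h,
    Measure.restrict_congr_set h]

lemma measure_busEvent_pos (hX : ∀ i, IsPoissonProcess (X i) 1 P)
    (hX_indep : iIndepFun (fun i ω s => X i s ω) P) (N : ℕ) {T : ℝ≥0} (hT : 0 < T) :
    0 < P (busEvent X N T) := by
  have h := measureReal_ordered_end hX hX_indep N hT
  rw [← measureReal_congr (busEvent_ae_eq hX hX_indep N T)] at h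
  have h1 : 0 < P.real (busEvent X N T) := by
    rw [h]
    exact mul_pos (massFactor_pos n N (by exact_mod_cast hT)) (totalWeight_pos (by omega))
  exact (ENNReal.toReal_pos_iff.1 h1).1

/-- The conditional law of the configurations at the times `t j`. -/
theorem busLaw_real_config (hX : ∀ i, IsPoissonProcess (X i) 1 P)
    (hX_indep : iIndepFun (fun i ω s => X i s ω) P) (N : ℕ) {T : ℝ≥0} (hT : 0 < T)
    {t : Fin (m + 1) → ℝ≥0} (ht : Monotone t) (htT : t (Fin.last m) ≤ T) {p : Fin (m + 1) → ℝ}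
    (hp : ∀ j, p j = (t j : ℝ) / (T : ℝ)) {x : Fin (m + 1) → Fin n → ℕ}
    (hx : ∀ j, StrictAnti (x j)) :
    (busLaw P X N T).real {ω | ∀ j i, shiftedPos X i (t j) ω = (x j i : ℤ)} =
      chainWeight (N + n) p x / totalWeight ℝ n (N + n) := by
  rw [busLaw_eq_cond hX hX_indep, measureReal_def, cond_apply (measurableSet_ordered_end hX N T),
    ENNReal.toReal_mul, ENNReal.toReal_inv, ← measureReal_def, ← measureReal_def,
    measureReal_ordered_end_inter hX hX_indep N hT ht htT hp hx,
    measureReal_ordered_end hX hX_indep N hT]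
  have := (massFactor_pos n N (T := T) (by exact_mod_cast hT)).ne'
  have := (totalWeight_pos (n := n) (d := N + n) (by omega)).ne'
  field_simp

/-- Almost surely, the buses are ordered and on the sites `0, …, N + n - 1`; they cannot be further
to the right, since they move to the right and end at `endConf`. -/
lemma busLaw_ae_strictAnti (hX : ∀ i, IsPoissonProcess (X i) 1 P)
    (hX_indep : iIndepFun (fun i ω s => X i s ω) P) (N : ℕ) (T : ℝ≥0) :
    ∀ᵐ ω ∂busLaw P X N T, ∀ s ≤ T, (StrictAnti fun i => shiftedPos X i s ω) ∧
      ∀ i, 0 ≤ shiftedPos X i s ω ∧ shiftedPos X i s ω ≤ (N : ℤ) + n - 1 := by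
  rw [busLaw_eq_cond hX hX_indep]
  filter_upwards [ae_cond_mem (measurableSet_ordered_end hX N T)] with ω hω s hs
  refine ⟨hω.1 s hs, fun i => ⟨shiftedPos_nonneg i s ω, ?_⟩⟩
  have h1 : X i s ω ≤ X i T ω := (hX i).monotone ω hs
  have h2 := hω.2 i
  simp only [shiftedPos, busPos, endConf] at h2 ⊢
  omega

/-- The correlation functions of the conditional law, as determinants of the space-time kernel of
`modeMatrix` and `siteMatrix`. -/
theorem correlation_eq_det (hX : ∀ i, IsPoissonProcess (X i) 1 P)
    (hX_indep : iIndepFun (fun i ω s => X i s ω) P) (N : ℕ) {T : ℝ≥0} (hT : 0 < T)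
    {t : Fin (m + 1) → ℝ≥0} (ht : Monotone t) (htT : t (Fin.last m) ≤ T) {p : Fin (m + 1) → ℝ}
    (hp : ∀ j, p j = (t j : ℝ) / (T : ℝ)) {r : ℕ} (z : Fin r → Fin (m + 1) × Fin (N + n))
    (hz : Function.Injective z) :
    ((correlation (busLaw P X N T) X t z : ℝ) : ℂ) =
      ((spaceTimeKernel n (fun l => modeMatrix (N + n) (p l : ℂ))
        (fun l => siteMatrix (N + n) (p l : ℂ))).submatrix z z).det := by
  classical
  set S : Set Ω := {ω | ∀ a, ∃ i, shiftedPos X i (t (z a).1) ω = (((z a).2 : ℕ) : ℤ)} with hS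
  set A : (Fin (m + 1) → Conf n (N + n)) → Set Ω :=
    fun x => {ω | ∀ j i, shiftedPos X i (t j) ω = (((x j).1 i : ℕ) : ℤ)} with hA
  have hAm : ∀ x, MeasurableSet (A x) := fun x => by
    have : A x = ⋂ j, ⋂ i, shiftedPos X i (t j) ⁻¹' {(((x j).1 i : ℕ) : ℤ)} := by
      ext; simp [hA]
    rw [this]
    refine MeasurableSet.iInter fun j => MeasurableSet.iInter fun i => ?_
    have h1 : Measurable fun k : ℕ => (k : ℤ) - (i : ℕ) + n - 1 := measurable_from_top
    exact (h1.comp ((hX i).measurable (t j))) (measurableSet_singleton _)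
  have hAd : Pairwise (Function.onFun Disjoint A) := fun x x' hxx' =>
    Set.disjoint_left.2 fun ω hω hω' => hxx' <| funext fun j => Subtype.ext <| funext fun i =>
      Fin.ext (by exact_mod_cast (hω j i).symm.trans (hω' j i))
  -- the configuration chains for which the event `S` occurs
  set good : Finset (Fin (m + 1) → Conf n (N + n)) :=
    Finset.univ.filter fun x => ∀ a, ∃ i, (x (z a).1).1 i = (z a).2 with hgood
  have hSA : S =ᵐ[busLaw P X N T] (⋃ x ∈ good, A x : Set Ω) := by
    refine Filter.eventuallyEq_set.2 ?_
    filter_upwards [busLaw_ae_strictAnti hX hX_indep N T] with ω hω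
    have hω' := fun j => hω (t j) ((ht (Fin.le_last j)).trans htT)
    simp only [mem_iUnion, exists_prop]
    constructor
    · intro h
      have hlt : ∀ j i, (shiftedPos X i (t j) ω).toNat < N + n := fun j i => by
        have := (hω' j).2 i
        have := i.2
        omega
      have hnat : ∀ j i, ((shiftedPos X i (t j) ω).toNat : ℤ) = shiftedPos X i (t j) ω :=
        fun j i => Int.toNat_of_nonneg ((hω' j).2 i).1
      refine ⟨fun j => ⟨fun i => ⟨_, hlt j i⟩, fun a b hab => ?_⟩, ?_, fun j i => (hnat j i).symm⟩
      · have h1 := (hω' j).1 hab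
        have h2 := hnat j a
        have h3 := hnat j b
        refine Fin.lt_def.2 ?_
        simp only at h1 ⊢
        omega
      · refine Finset.mem_filter.2 ⟨Finset.mem_univ _, fun a => ?_⟩
        obtain ⟨i, hi⟩ := h a
        refine ⟨i, Fin.ext ?_⟩
        simp only [hi, Int.toNat_natCast]
    · rintro ⟨x, hx, hxA⟩ a
      obtain ⟨i, hi⟩ := (Finset.mem_filter.1 hx).2 a
      exact ⟨i, by rw [hxA, hi]⟩
  have h1 : correlation (busLaw P X N T) X t z =
      ∑ x ∈ good, chainWeight (N + n) p (fun j i => ((x j).1 i : ℕ)) /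
        totalWeight ℝ n (N + n) := by
    have hfin : IsFiniteMeasure (busLaw P X N T) := by
      rw [busLaw]
      infer_instance
    rw [correlation, measureReal_congr hSA,
      measureReal_biUnion_finset (fun x _ y _ hxy => hAd hxy) fun x _ => hAm x]
    refine Finset.sum_congr rfl fun x _ => ?_
    exact busLaw_real_config hX hX_indep N hT ht htT hp fun j a b hab => (x j).2 hab
  have h2 := sum_binomTrans_chain_indicator_eq_det (n := n) (d := N + n) (by omega)
    (fun l => (p l : ℂ)) z hz
  have h3 : totalWeight ℂ n (N + n) ≠ 0 := by
    rw [← ofReal_totalWeight]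
    exact Complex.ofReal_ne_zero.2 (totalWeight_pos (by omega)).ne'
  rw [h1, ← Finset.sum_div, Complex.ofReal_div, ofReal_totalWeight, div_eq_iff h3, mul_comm]
  refine Eq.trans ?_ h2
  rw [hgood, Finset.sum_filter, Complex.ofReal_sum]
  refine Finset.sum_congr rfl fun x _ => ?_
  split_ifs
  · rw [ofReal_chainWeight, mul_one]
    rfl
  · rw [Complex.ofReal_zero, mul_zero]

end ConditionalLaw

end BusModel

theorem mainTheorem8 {Ω : Type*} [MeasurableSpace Ω] (P : Measure Ω) [IsProbabilityMeasure P]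
    (n N m : ℕ) (hN : n < N) (T : ℝ≥0)
    (t : Fin (m + 1) → ℝ≥0) (ht_pos : 0 < t 0) (ht_mono : StrictMono t) (ht_lt : t (Fin.last m) < T)
    (X : Fin n → ℝ≥0 → Ω → ℕ) (hX : ∀ i, BusModel.IsPoissonProcess (X i) 1 P)
    (hX_indep : iIndepFun (fun i ω s => X i s ω) P)
    (p : Fin (m + 1) → ℝ) (hp : ∀ j, p j = (t j : ℝ) / (T : ℝ)) :
    -- the conditioning is on an event of positive probability
    0 < P (BusModel.busEvent X N T) ∧
    -- the configurations are decreasing, with shifted sites in `{0, …, N + n - 1}`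
    (∀ᵐ ω ∂(BusModel.busLaw P X N T), ∀ j,
      StrictAnti (fun i => BusModel.shiftedPos X i (t j) ω) ∧
      ∀ i, 0 ≤ BusModel.shiftedPos X i (t j) ω ∧
        BusModel.shiftedPos X i (t j) ω ≤ (N : ℤ) + n - 1) ∧
    -- the explicit joint law at the times `t 0 < … < t m`
    (∃ C : ℝ, 0 < C ∧ ∀ x : Fin (m + 1) → Fin n → ℕ,
      (∀ j, StrictAnti (x j)) → (∀ j i, x j i < N + n) →
      (BusModel.busLaw P X N T).real
          {ω | ∀ j i, BusModel.shiftedPos X i (t j) ω = (x j i : ℤ)} =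
        C * BusModel.multiTimeWeight N p x) ∧
    -- admissible contours exist, and for every choice of them the process is determinantal
    (∀ i j, ∃ σ τ : ℝ → ℂ, BusModel.AdmissibleContours (p i) (p j) σ τ) ∧
    (∀ σ τ : Fin (m + 1) → Fin (m + 1) → ℝ → ℂ,
      (∀ i j, BusModel.AdmissibleContours (p i) (p j) (σ i j) (τ i j)) →
      BusModel.IsDeterminantal (N + n) (BusModel.busLaw P X N T) X t
        (fun i j x y => BusModel.busKernel n N (p i) (p j) (σ i j) (τ i j) x y)) := by
  have hT : 0 < T := lt_of_le_of_lt zero_le ht_lt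
  have hT' : (0 : ℝ) < T := by exact_mod_cast hT
  have hp_mono : StrictMono p := fun i j hij => by
    rw [hp, hp]
    exact div_lt_div_of_pos_right (by exact_mod_cast ht_mono hij) hT'
  have hp_pos : ∀ j, 0 < p j := fun j => by
    rw [hp]
    have : 0 < t j := ht_pos.trans_le (ht_mono.monotone (Fin.zero_le j))
    exact div_pos (by exact_mod_cast this) hT'
  have hp_lt : ∀ j, p j < 1 := fun j => by
    rw [hp, div_lt_one hT']
    exact_mod_cast (ht_mono.monotone (Fin.le_last j)).trans_lt ht_lt
  refine ⟨BusModel.measure_busEvent_pos hX hX_indep N hT, ?_, ?_, fun i j =>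
    BusModel.exists_admissibleContours (hp_pos i) (hp_lt i), fun σ τ hστ r z hz => ?_⟩
  · filter_upwards [BusModel.busLaw_ae_strictAnti hX hX_indep N T] with ω hω j
    exact hω (t j) ((ht_mono.monotone (Fin.le_last j)).trans ht_lt.le)
  · obtain ⟨c, hc, h⟩ := BusModel.exists_chainWeight_eq_mul_multiTimeWeight (n := n) (N := N)
      (hp_pos 0) (hp_lt (Fin.last m))
    refine ⟨c / BusModel.totalWeight ℝ n (N + n),
      div_pos hc (BusModel.totalWeight_pos (Nat.le_add_left n N)), fun x hx hxN => ?_⟩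
    rw [BusModel.busLaw_real_config hX hX_indep N hT ht_mono.monotone ht_lt.le hp hx, h x hxN]
    ring
  · rw [BusModel.correlation_eq_det hX hX_indep N hT ht_mono.monotone ht_lt.le hp z hz]
    congr 1
    ext a b
    refine Eq.trans ?_ (BusModel.busKernel_eq_spaceTimeKernel (hp_lt _)
      (hστ (z a).1 (z b).1) (z a).2 (z b).2).symm
    simp only [Matrix.submatrix_apply, BusModel.spaceTimeKernel, Matrix.of_apply,
      hp_mono.lt_iff_lt]
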